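/- Let $\mathcal C$ be a monoidal category, let $\mathcal D$ be a preadditive monoidal category whose tensor product is additive in each variable (for instance, $\mathcal C$ and $\mathcal D$ abelian monoidal categories), and let $F:\mathcal C\to\mathcal D$ be a (lax) monoidal functor with structure morphisms $\eta:\mathbf 1\to F\mathbf 1$ and $\mu:FX\otimes FY\to F(X\otimes Y)$. The canonical associativity and unit isomorphisms are suppressed, and morphisms are written element-wise. For $k\ge 0$ let $C^k(F)$ be the (possibly large) abelian group of natural transformations $$c^{X_1,\dots,X_k}:FX_1\otimes\cdots\otimes FX_k\to F(X_1\otimes\cdots\otimes X_k)$$ of functors of $k$ variables; for $k=0$ these are the morphisms $c:\mathbf 1\to F\mathbf 1$. Define $d:C^k(F)\to C^{k+1}(F)$ by $(dc)(n_1)=\mu(n_1,c)-\mu(c,n_1)$ for $k=0$ and, for $k>0$, by $$(dc)(n_1,\dots,n_{k+1})=(-1)^{k-1}\mu(n_1,c(n_2,\dots,n_{k+1}))+\sum_{i=1}^{k}(-1)^{i+k-1}c(n_1,\dots,\mu(n_i,n_{i+1}),\dots,n_{k+1})+\mu(c(n_1,\dots,n_k),n_{k+1}).$$ For $c\in C^i(F)$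 and $e\in C^j(F)$ define the product $ce\in C^{i+j}(F)$ by $$(ce)(n_1,\dots,n_{i+j})=(-1)^{ij}\mu\bigl(c(n_1,\dots,n_i),e(n_{i+1},\dots,n_{i+j})\bigr),$$ and, in degree $i+j-1$, $$(c\circ e)(n_1,\dots,n_{i+j-1})=\sum_{p=0}^{i-1}(-1)^{(j-1)p}\,c\bigl(n_1,\dots,n_p,e(n_{p+1},\dots,n_{p+j}),n_{p+j+1},\dots,n_{i+j-1}\bigr),$$ $$\{c,e\}=c\circ e-(-1)^{(i+1)(j+1)}\,e\circ c ,$$ where $\{c,e\}=0$ if $i=j=0$. Then $d\circ d=0$. The product and the bracket of two cocycles are cocycles, and their cohomology classes depend only on the classes of the two cocycles. On the Hochschild cohomology $HH^\bullet(F)=\ker d/\operatorname{im}d$ (with $HH^n(F)=0$ for $n<0$) the induced operations form a Gerstenhaber algebra with unit the class of $\eta$. That is, both operations are biadditive, and for $a,b,c$ of degrees $i,j,k$: 1. the product is associative, is graded commutative ($ab=(-1)^{ij}ba$), and has $[\eta]\in HH^0(F)$ as its unit; 2. $\{a,b\}=-(-1)^{(i-1)(j-1)}\{b,a\}$; 3.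 $\{a,\{b,c\}\}=\{\{a,b\},c\}+(-1)^{(i-1)(j-1)}\{b,\{a,c\}\}$; 4. $\{a,bc\}=\{a,b\}c+(-1)^{(i-1)j}b\{a,c\}$. -/

import Mathlib

open CategoryTheory MonoidalCategory

universe v u v' u'

/-! ### Iterated tensor products as functors of several variables -/

section TensorPower

/-- `(X₁, …, X_{n+1}) ↦ (X₂, …, X_{n+1})`. -/
abbrev tailArgs (C : Type u) [Category.{v} C] (n : ℕ) : (Fin (n + 1) → C) ⥤ (Fin n → C) :=
  Pi.comap (fun _ => C) Fin.succ

/-- `(X₁, …, X_{b+j}) ↦ (X₁, …, X_j)`. -/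
abbrev firstArgs (C : Type u) [Category.{v} C] (b j : ℕ) : (Fin (b + j) → C) ⥤ (Fin j → C) :=
  Pi.comap (fun _ => C) (fun r : Fin j => r.castLE (Nat.le_add_left j b))

/-- `(X₁, …, X_{b+j}) ↦ (X_{j+1}, …, X_{j+b})`. -/
abbrev lastArgs (C : Type u) [Category.{v} C] (b j : ℕ) : (Fin (b + j) → C) ⥤ (Fin b → C) :=
  Pi.comap (fun _ => C) (fun r : Fin b => r.addNat j)

/-- `(X₁, …, X_n) ↦ (G X, H₁ X, …, H_n X)`. -/
abbrev consArgs {E : Type u'} [Category.{v'} E] {C : Type u} [Category.{v} C] {n : ℕ}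
    (G : E ⥤ C) (H : E ⥤ (Fin n → C)) : E ⥤ (Fin (n + 1) → C) :=
  Functor.pi' (fun q => Fin.cases (motive := fun _ => E ⥤ C) G (fun r => H ⋙ Pi.eval _ r) q)

variable (C : Type u) [Category.{v} C] [MonoidalCategory C]

/-- The functor `(X₁, …, X_n) ↦ X₁ ⊗ ⋯ ⊗ X_n` of `n` variables. Of the canonically isomorphic
bracketings we choose `X₁ ⊗ (X₂ ⊗ (⋯ ⊗ (X_n ⊗ 𝟙)))`; for `n = 0` this is the unit object `𝟙`. -/
def tensorPower : (n : ℕ) → (Fin n → C) ⥤ C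
  | 0 => (Functor.const _).obj (𝟙_ C)
  | n + 1 =>
    { obj X := X 0 ⊗ (tensorPower n).obj ((tailArgs C n).obj X)
      map f := f 0 ⊗ₘ (tensorPower n).map ((tailArgs C n).map f)
      map_id X := by
        rw [CategoryTheory.Functor.map_id, CategoryTheory.Functor.map_id]
        simp
      map_comp f g := by
        rw [CategoryTheory.Functor.map_comp, CategoryTheory.Functor.map_comp]
        simp }

variable {C}

/-- The canonical isomorphism
`X₁ ⊗ ⋯ ⊗ X_{j+b} ≅ (X₁ ⊗ ⋯ ⊗ X_j) ⊗ (X_{j+1} ⊗ ⋯ ⊗ X_{j+b})`. -/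
def splitIso (b : ℕ) : (j : ℕ) → (X : Fin (b + j) → C) →
    ((tensorPower C (b + j)).obj X ≅
      (tensorPower C j).obj ((firstArgs C b j).obj X) ⊗
        (tensorPower C b).obj ((lastArgs C b j).obj X))
  | 0, X => (λ_ ((tensorPower C b).obj X)).symm
  | j + 1, X =>
    whiskerLeftIso (X 0) (splitIso b j ((tailArgs C _).obj X)) ≪≫ (α_ _ _ _).symm

theorem splitIso_naturality (b : ℕ) : (j : ℕ) → {X Y : Fin (b + j) → C} → (f : X ⟶ Y) →
    (tensorPower C (b + j)).map f ≫ (splitIso b j Y).hom =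
      (splitIso b j X).hom ≫ ((tensorPower C j).map ((firstArgs C b j).map f) ⊗ₘ
        (tensorPower C b).map ((lastArgs C b j).map f))
  | 0, X, Y, f => by
    change (tensorPower C b).map f ≫ (λ_ ((tensorPower C b).obj Y)).inv =
      (λ_ ((tensorPower C b).obj X)).inv ≫ (𝟙 _ ⊗ₘ (tensorPower C b).map f)
    simp
  | j + 1, X, Y, f => by
    have ih := splitIso_naturality b j ((tailArgs C _).map f)
    change (f 0 ⊗ₘ (tensorPower C (b + j)).map ((tailArgs C (b + j)).map f)) ≫
        (Y 0 ◁ (splitIso b j ((tailArgs C _).obj Y)).hom ≫ (α_ _ _ _).inv) =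
      (X 0 ◁ (splitIso b j ((tailArgs C _).obj X)).hom ≫ (α_ _ _ _).inv) ≫
        ((f 0 ⊗ₘ (tensorPower C j).map ((firstArgs C b j).map ((tailArgs C _).map f))) ⊗ₘ
          (tensorPower C b).map ((lastArgs C b j).map ((tailArgs C _).map f)))
    rw [MonoidalCategory.tensorHom_def', Category.assoc, ← whisker_exchange_assoc, ← whiskerLeft_comp_assoc, ih]
    simp [MonoidalCategory.tensorHom_def']

variable (C) in
/-- With `n = b + j + p`:
`(X₁, …, X_n) ↦ (X₁, …, X_p, X_{p+1} ⊗ ⋯ ⊗ X_{p+j}, X_{p+j+1}, …, X_n)`. -/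
def groupArgs (b j : ℕ) : (p : ℕ) → (Fin (b + j + p) → C) ⥤ (Fin (b + 1 + p) → C)
  | 0 => consArgs (firstArgs C b j ⋙ tensorPower C j) (lastArgs C b j)
  | p + 1 => consArgs (Pi.eval _ 0) (tailArgs C _ ⋙ groupArgs b j p)

/-- The canonical isomorphism `X₁ ⊗ ⋯ ⊗ X_n ≅
X₁ ⊗ ⋯ ⊗ X_p ⊗ (X_{p+1} ⊗ ⋯ ⊗ X_{p+j}) ⊗ X_{p+j+1} ⊗ ⋯ ⊗ X_n`, where `n = b + j + p`. -/
def groupIso (b j : ℕ) : (p : ℕ) → (X : Fin (b + j + p) → C) →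
    ((tensorPower C (b + j + p)).obj X ≅
      (tensorPower C (b + 1 + p)).obj ((groupArgs C b j p).obj X))
  | 0, X => splitIso b j X
  | p + 1, X => whiskerLeftIso (X 0) (groupIso b j p ((tailArgs C _).obj X))

theorem groupIso_naturality (b j : ℕ) : (p : ℕ) → {X Y : Fin (b + j + p) → C} → (f : X ⟶ Y) →
    (tensorPower C (b + j + p)).map f ≫ (groupIso b j p Y).hom =
      (groupIso b j p X).hom ≫ (tensorPower C (b + 1 + p)).map ((groupArgs C b j p).map f)
  | 0, _, _, f => splitIso_naturality b j f
  | p + 1, X, Y, f => by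
    have ih := groupIso_naturality b j p ((tailArgs C _).map f)
    change (f 0 ⊗ₘ (tensorPower C (b + j + p)).map ((tailArgs C _).map f)) ≫
        Y 0 ◁ (groupIso b j p ((tailArgs C _).obj Y)).hom =
      X 0 ◁ (groupIso b j p ((tailArgs C _).obj X)).hom ≫
        (f 0 ⊗ₘ (tensorPower C (b + 1 + p)).map ((groupArgs C b j p).map ((tailArgs C _).map f)))
    rw [MonoidalCategory.tensorHom_def', Category.assoc, ← whisker_exchange, ← whiskerLeft_comp_assoc, ih]
    simp [MonoidalCategory.tensorHom_def', whisker_exchange]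

end TensorPower

/-! ### Hochschild cochains of a monoidal functor -/

namespace MonoidalHochschild

theorem comp_square {D : Type u} [Category.{v} D] {P P' Q Q' R R' : D} {p : P ⟶ P'} {q : Q ⟶ Q'} {r : R ⟶ R'}
    {a : P ⟶ Q} {a' : P' ⟶ Q'} {b : Q ⟶ R} {b' : Q' ⟶ R'}
    (h : p ≫ a' = a ≫ q) (h' : q ≫ b' = b ≫ r) : p ≫ a' ≫ b' = (a ≫ b) ≫ r := by
  rw [reassoc_of% h, h', Category.assoc]

theorem map_square {C : Type u} [Category.{v} C] {D : Type u'} [Category.{v'} D] (F : C ⥤ D)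
    {P P' Q Q' : C} {p : P ⟶ P'} {q : Q ⟶ Q'}
    {a : P ⟶ Q} {a' : P' ⟶ Q'} (h : p ≫ a' = a ≫ q) :
    F.map p ≫ F.map a' = F.map a ≫ F.map q := by
  rw [← F.map_comp, h, F.map_comp]

variable {C : Type u} [Category.{v} C] [MonoidalCategory C]
  {D : Type u'} [Category.{v'} D] [MonoidalCategory D]

/-- `(X₁, …, X_n) ↦ (F X₁, …, F X_n)`. -/
abbrev mapArgs (F : C ⥤ D) (n : ℕ) : (Fin n → C) ⥤ (Fin n → D) :=
  Functor.pi (fun _ => F)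

/-- The `n`-cochains: natural transformations
`F X₁ ⊗ ⋯ ⊗ F X_n ⟶ F (X₁ ⊗ ⋯ ⊗ X_n)` of functors of `n` variables. For `n = 0` these are
the morphisms `𝟙 ⟶ F 𝟙`. -/
abbrev Cochain (F : C ⥤ D) (n : ℕ) :=
  mapArgs F n ⋙ tensorPower D n ⟶ tensorPower C n ⋙ F

variable {F : C ⥤ D}

/-- Transport of cochains along an equality of degrees. -/
def Cochain.cast {m n : ℕ} (h : m = n) (c : Cochain F m) : Cochain F n := h ▸ c

/-- The morphism `F X₁ ⊗ ⋯ ⊗ F X_n ⟶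
F X₁ ⊗ ⋯ ⊗ F X_p ⊗ F (X_{p+1} ⊗ ⋯ ⊗ X_{p+j}) ⊗ F X_{p+j+1} ⊗ ⋯ ⊗ F X_n`, where
`n = b + j + p`, given by the cochain `e` in the middle and by identities elsewhere. -/
def applyAt (b : ℕ) {j : ℕ} (e : Cochain F j) : (p : ℕ) → (X : Fin (b + j + p) → C) →
    ((tensorPower D (b + j + p)).obj ((mapArgs F _).obj X) ⟶
      (tensorPower D (b + 1 + p)).obj ((mapArgs F _).obj ((groupArgs C b j p).obj X)))
  | 0, X => (splitIso b j ((mapArgs F _).obj X)).hom ≫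
      e.app ((firstArgs C b j).obj X) ▷
        (tensorPower D b).obj ((mapArgs F b).obj ((lastArgs C b j).obj X))
  | p + 1, X => F.obj (X 0) ◁ applyAt b e p ((tailArgs C _).obj X)

theorem tensorHom_square {P P' Q Q' R R' S S' : D} {p : P ⟶ P'} {q : Q ⟶ Q'} {r : R ⟶ R'}
    {s : S ⟶ S'} {a : P ⟶ Q} {a' : P' ⟶ Q'} {b : R ⟶ S} {b' : R' ⟶ S'}
    (h : p ≫ a' = a ≫ q) (h' : r ≫ b' = b ≫ s) :
    (p ⊗ₘ r) ≫ (a' ⊗ₘ b') = (a ⊗ₘ b) ≫ (q ⊗ₘ s) := by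
  rw [tensorHom_comp_tensorHom, tensorHom_comp_tensorHom, h, h']

theorem rightUnitor_square {P Q : D} (f : P ⟶ Q) :
    (f ⊗ₘ 𝟙 (𝟙_ D)) ≫ (ρ_ Q).hom = (ρ_ P).hom ≫ f := by
  simp

theorem rightUnitor_inv_square {P Q : D} (f : P ⟶ Q) :
    f ≫ (ρ_ Q).inv = (ρ_ P).inv ≫ (f ⊗ₘ 𝟙 (𝟙_ D)) := by
  simp

theorem whiskerRight_square {P P' A A' B B' E E' : D} {m : P ⟶ P'} {s : P ⟶ A ⊗ B}
    {s' : P' ⟶ A' ⊗ B'} {a : A ⟶ A'} {b : B ⟶ B'} {e : A ⟶ E} {e' : A' ⟶ E'} {g : E ⟶ E'}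
    (hs : m ≫ s' = s ≫ (a ⊗ₘ b)) (he : a ≫ e' = e ≫ g) :
    m ≫ s' ≫ e' ▷ B' = (s ≫ e ▷ B) ≫ (g ⊗ₘ b) := by
  rw [reassoc_of% hs, MonoidalCategory.tensorHom_def', Category.assoc, Category.assoc,
    ← comp_whiskerRight, he, MonoidalCategory.tensorHom_def', comp_whiskerRight,
    whisker_exchange_assoc]

theorem applyAt_naturality (b : ℕ) {j : ℕ} (e : Cochain F j) : (p : ℕ) →
    {X Y : Fin (b + j + p) → C} → (f : X ⟶ Y) →
    (tensorPower D (b + j + p)).map ((mapArgs F _).map f) ≫ applyAt b e p Y =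
      applyAt b e p X ≫
        (tensorPower D (b + 1 + p)).map ((mapArgs F _).map ((groupArgs C b j p).map f))
  | 0, X, Y, f =>
    whiskerRight_square (splitIso_naturality b j ((mapArgs F _).map f))
      (e.naturality ((firstArgs C b j).map f))
  | p + 1, X, Y, f => by
    have ih := applyAt_naturality b e p ((tailArgs C _).map f)
    change (F.map (f 0) ⊗ₘ (tensorPower D (b + j + p)).map
          ((mapArgs F _).map ((tailArgs C _).map f))) ≫
        F.obj (Y 0) ◁ applyAt b e p ((tailArgs C _).obj Y) =
      F.obj (X 0) ◁ applyAt b e p ((tailArgs C _).obj X) ≫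
        (F.map (f 0) ⊗ₘ (tensorPower D (b + 1 + p)).map
          ((mapArgs F _).map ((groupArgs C b j p).map ((tailArgs C _).map f))))
    rw [MonoidalCategory.tensorHom_def', Category.assoc, ← whisker_exchange, ← whiskerLeft_comp_assoc, ih]
    simp [MonoidalCategory.tensorHom_def', whisker_exchange]

/-- The insertion of `e` into the slot number `p + 1` of `c`:
`(n₁, …, n_{b+j+p}) ↦ c (n₁, …, n_p, e (n_{p+1}, …, n_{p+j}), n_{p+j+1}, …, n_{b+j+p})`. -/
def insert (b j p : ℕ) (c : Cochain F (b + 1 + p)) (e : Cochain F j) :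
    Cochain F (b + j + p) where
  app X := applyAt b e p X ≫ c.app ((groupArgs C b j p).obj X) ≫ F.map (groupIso b j p X).inv
  naturality X Y f := by
    have hg : (groupIso b j p X).inv ≫ (tensorPower C _).map f =
        (tensorPower C _).map ((groupArgs C b j p).map f) ≫ (groupIso b j p Y).inv := by
      rw [Iso.inv_comp_eq, ← Category.assoc, ← groupIso_naturality, Category.assoc,
        Iso.hom_inv_id, Category.comp_id]
    exact comp_square (applyAt_naturality b e p f)
      (comp_square (c.naturality ((groupArgs C b j p).map f)) (map_square F hg.symm))

/-- The identity of `F` as a `1`-cochain. -/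
def idCochain (F : C ⥤ D) : Cochain F 1 where
  app X := (ρ_ (F.obj (X 0))).hom ≫ F.map (ρ_ (X 0)).inv
  naturality X Y f := by
    have h (g : X 0 ⟶ Y 0) : (F.map g ⊗ₘ 𝟙 (𝟙_ D)) ≫ (ρ_ (F.obj (Y 0))).hom ≫
        F.map (ρ_ (Y 0)).inv =
        ((ρ_ (F.obj (X 0))).hom ≫ F.map (ρ_ (X 0)).inv) ≫ F.map (g ⊗ₘ 𝟙 (𝟙_ C)) :=
      comp_square (q := F.map g) (by simp) (map_square F (by simp))
    exact h (f 0)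

section LaxMonoidal

variable [F.LaxMonoidal]

/-- `(n₁, …, n_{i+j}) ↦ μ (c (n₁, …, n_i), e (n_{i+1}, …, n_{i+j}))`. -/
def juxt {i j : ℕ} (c : Cochain F i) (e : Cochain F j) : Cochain F (j + i) where
  app X := (splitIso j i ((mapArgs F _).obj X)).hom ≫
    (c.app ((firstArgs C j i).obj X) ⊗ₘ e.app ((lastArgs C j i).obj X)) ≫
      Functor.LaxMonoidal.μ F _ _ ≫ F.map (splitIso j i X).inv
  naturality X Y f := by
    have hg : (splitIso j i X).inv ≫ (tensorPower C _).map f =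
        ((tensorPower C i).map ((firstArgs C j i).map f) ⊗ₘ
          (tensorPower C j).map ((lastArgs C j i).map f)) ≫ (splitIso j i Y).inv := by
      rw [Iso.inv_comp_eq, ← Category.assoc, ← splitIso_naturality, Category.assoc,
        Iso.hom_inv_id, Category.comp_id]
    exact comp_square (splitIso_naturality j i ((mapArgs F _).map f))
      (comp_square (tensorHom_square (c.naturality ((firstArgs C j i).map f))
        (e.naturality ((lastArgs C j i).map f)))
        (comp_square (Functor.LaxMonoidal.μ_natural F _ _) (map_square F hg.symm)))

variable (F)

/-- The unit `η : 𝟙 ⟶ F 𝟙` of the monoidal functor as a `0`-cochain. -/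
def unitCochain : Cochain F 0 where
  app _ := Functor.LaxMonoidal.ε F
  naturality X Y f := by
    have h : 𝟙 (𝟙_ D) ≫ Functor.LaxMonoidal.ε F =
        Functor.LaxMonoidal.ε F ≫ F.map (𝟙 (𝟙_ C)) := by simp
    exact h

/-- The structure morphism `μ : F X₁ ⊗ F X₂ ⟶ F (X₁ ⊗ X₂)` as a `2`-cochain. -/
def mulCochain : Cochain F 2 where
  app X := F.obj (X 0) ◁ (ρ_ (F.obj (X 1))).hom ≫ Functor.LaxMonoidal.μ F (X 0) (X 1) ≫
    F.map (X 0 ◁ (ρ_ (X 1)).inv)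
  naturality X Y f := by
    have h (g : X 0 ⟶ Y 0) (k : X 1 ⟶ Y 1) :
        (F.map g ⊗ₘ (F.map k ⊗ₘ 𝟙 (𝟙_ D))) ≫ F.obj (Y 0) ◁ (ρ_ (F.obj (Y 1))).hom ≫
          Functor.LaxMonoidal.μ F (Y 0) (Y 1) ≫ F.map (Y 0 ◁ (ρ_ (Y 1)).inv) =
        (F.obj (X 0) ◁ (ρ_ (F.obj (X 1))).hom ≫ Functor.LaxMonoidal.μ F (X 0) (X 1) ≫
          F.map (X 0 ◁ (ρ_ (X 1)).inv)) ≫ F.map (g ⊗ₘ (k ⊗ₘ 𝟙 (𝟙_ C))) :=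
      comp_square (q := F.map g ⊗ₘ F.map k)
        (by
          simpa only [id_tensorHom] using tensorHom_square (p := F.map g) (a := 𝟙 _) (a' := 𝟙 _)
            (q := F.map g) (by simp) (rightUnitor_square (F.map k)))
        (comp_square (Functor.LaxMonoidal.μ_natural F g k)
          (map_square F (by
            simpa only [id_tensorHom] using tensorHom_square (p := g) (a := 𝟙 _) (a' := 𝟙 _)
              (q := g) (by simp) (rightUnitor_inv_square k))))
    exact h (f 0) (f 1)

end LaxMonoidal

/-! ### The differential, the product and the bracket -/

section Preadditive

variable {D : Type u'} [Category.{v'} D] [Preadditive D] [MonoidalCategory D] {F : C ⥤ D}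

theorem Cochain.cast_add {m n : ℕ} (h : m = n) (c c' : Cochain F m) :
    (c + c').cast h = c.cast h + c'.cast h := by
  subst h; rfl

theorem insert_add_left (b j p : ℕ) (c c' : Cochain F (b + 1 + p)) (e : Cochain F j) :
    insert b j p (c + c') e = insert b j p c e + insert b j p c' e := by
  ext X
  exact (congrArg _ (Preadditive.add_comp _ _ _ _ _ _)).trans (Preadditive.comp_add _ _ _ _ _ _)

/-- `c ∘ e = ∑_p (-1) ^ ((j - 1) p) c (n₁, …, n_p, e (n_{p+1}, …, n_{p+j}), n_{p+j+1}, …, n_n)`,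
where `0 ≤ p ≤ i - 1` and `n = i + j - 1`. -/
def circ {i j n : ℕ} (c : Cochain F i) (e : Cochain F j) (h : i + j = n + 1) : Cochain F n :=
  ∑ p : Fin i, (((j : ℤ) - 1) * (p : ℕ)).negOnePow •
    (insert (i - 1 - p) j p (c.cast (by omega)) e).cast (by omega)

/-- `{c, e} = c ∘ e - (-1) ^ ((i + 1) (j + 1)) e ∘ c`. -/
def bracket {i j n : ℕ} (c : Cochain F i) (e : Cochain F j) (h : i + j = n + 1) : Cochain F n :=
  circ c e h - (((i : ℤ) + 1) * ((j : ℤ) + 1)).negOnePow • circ e c ((Nat.add_comm j i).trans h)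

variable [F.LaxMonoidal]

/-- `(c e) (n₁, …, n_{i+j}) = (-1) ^ (i j) μ (c (n₁, …, n_i), e (n_{i+1}, …, n_{i+j}))`. -/
def cup {i j n : ℕ} (c : Cochain F i) (e : Cochain F j) (h : i + j = n) : Cochain F n :=
  ((i : ℤ) * (j : ℤ)).negOnePow • (juxt c e).cast ((Nat.add_comm j i).trans h)

/-- The Hochschild differential. In degree zero `d c (n₁) = μ (n₁, c) - μ (c, n₁)`, and in degree
`k + 1` the element `d c (n₁, …, n_{k+2})` is
`(-1) ^ k μ (n₁, c (n₂, …)) + ∑_{p=0}^{k} (-1) ^ (p + 1 + k) c (…, μ (n_{p+1}, n_{p+2}), …)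
  + μ (c (n₁, …, n_{k+1}), n_{k+2})`. -/
def dFun : (k : ℕ) → Cochain F k → Cochain F (k + 1)
  | 0, c => (juxt (idCochain F) c).cast (by omega) - (juxt c (idCochain F)).cast (by omega)
  | k + 1, c => (k : ℤ).negOnePow • (juxt (idCochain F) c).cast (by omega) +
      ∑ p : Fin (k + 1), (((p : ℕ) : ℤ) + 1 + k).negOnePow •
        (insert (k - p) 2 p (c.cast (by omega)) (mulCochain F)).cast (by omega) +
      (juxt c (idCochain F)).cast (by omega)

variable [MonoidalPreadditive D]

theorem juxt_add_left {i j : ℕ} (c c' : Cochain F i) (e : Cochain F j) :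
    juxt (c + c') e = juxt c e + juxt c' e := by
  ext X
  have h {P P' Q Q' R S : D} (s : R ⟶ P ⊗ Q) (a a' : P ⟶ P') (b : Q ⟶ Q') (t : P' ⊗ Q' ⟶ S) :
      s ≫ ((a + a') ⊗ₘ b) ≫ t = s ≫ (a ⊗ₘ b) ≫ t + s ≫ (a' ⊗ₘ b) ≫ t := by
    simp [MonoidalPreadditive.add_tensor]
  exact h _ _ _ _ _

theorem juxt_add_right {i j : ℕ} (c : Cochain F i) (e e' : Cochain F j) :
    juxt c (e + e') = juxt c e + juxt c e' := by
  ext X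
  have h {P P' Q Q' R S : D} (s : R ⟶ P ⊗ Q) (a : P ⟶ P') (b b' : Q ⟶ Q') (t : P' ⊗ Q' ⟶ S) :
      s ≫ (a ⊗ₘ (b + b')) ≫ t = s ≫ (a ⊗ₘ b) ≫ t + s ≫ (a ⊗ₘ b') ≫ t := by
    simp [MonoidalPreadditive.tensor_add]
  exact h _ _ _ _ _

variable (F)

/-- The Hochschild differential as a homomorphism. -/
def d (k : ℕ) : Cochain F k →+ Cochain F (k + 1) :=
  AddMonoidHom.mk' (dFun k) (fun c c' => by
    cases k with
    | zero =>
      simp only [dFun, juxt_add_left, juxt_add_right, Cochain.cast_add]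
      abel
    | succ k =>
      simp only [dFun, juxt_add_left, juxt_add_right, Cochain.cast_add, insert_add_left, smul_add,
        Finset.sum_add_distrib]
      abel)

/-- The Hochschild `k`-cocycles. -/
def cocycles (k : ℕ) : AddSubgroup (Cochain F k) := (d F k).ker

/-- The Hochschild `k`-coboundaries. -/
def coboundaries : (k : ℕ) → AddSubgroup (Cochain F k)
  | 0 => ⊥
  | k + 1 => (d F k).range

/-- The Hochschild cohomology of `F` in degree `n : ℤ`: cocycles modulo coboundaries for `0 ≤ n`,
and zero for `n < 0`. -/
def HH : ℤ → Type (max u v')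
  | .ofNat k => cocycles F k ⧸ (coboundaries F k).addSubgroupOf (cocycles F k)
  | .negSucc _ => PUnit

instance : (n : ℤ) → AddCommGroup (HH F n)
  | .ofNat k =>
    inferInstanceAs (AddCommGroup (cocycles F k ⧸ (coboundaries F k).addSubgroupOf (cocycles F k)))
  | .negSucc _ => inferInstanceAs (AddCommGroup PUnit)

/-- The cohomology class of a cocycle. -/
def cls {k : ℕ} (x : Cochain F k) (hx : x ∈ cocycles F k) : HH F (k : ℤ) :=
  (QuotientAddGroup.mk ⟨x, hx⟩ :
    cocycles F k ⧸ (coboundaries F k).addSubgroupOf (cocycles F k))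

end Preadditive

end MonoidalHochschild

/-! ### Gerstenhaber algebras -/

/-- A (unital) Gerstenhaber algebra structure on a `ℤ`-graded abelian group: a graded commutative
associative product of degree `0` and a graded Lie bracket of degree `-1` that acts by graded
derivations of the product. The degree of a result is a variable `n` subject to an equation. -/
structure GerstenhaberAlgebra (A : ℤ → Type u) [∀ n, AddCommGroup (A n)] where
  /-- The product. -/
  mul {i j n : ℤ} (h : i + j = n) : A i →+ A j →+ A n
  /-- The unit. -/
  one : A 0
  /-- The bracket. -/
  bracket {i j n : ℤ} (h : i + j = n + 1) : A i →+ A j →+ A n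
  one_mul {i : ℤ} (a : A i) : mul (zero_add i) one a = a
  mul_one {i : ℤ} (a : A i) : mul (add_zero i) a one = a
  mul_assoc {i j k ij jk n : ℤ} (hij : i + j = ij) (hjk : j + k = jk) (h : ij + k = n)
    (h' : i + jk = n) (a : A i) (b : A j) (c : A k) :
    mul h (mul hij a b) c = mul h' a (mul hjk b c)
  mul_comm {i j n : ℤ} (h : i + j = n) (h' : j + i = n) (a : A i) (b : A j) :
    mul h a b = (i * j).negOnePow • mul h' b a
  bracket_antisymm {i j n : ℤ} (h : i + j = n + 1) (h' : j + i = n + 1) (a : A i) (b : A j) :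
    bracket h a b = -(((i - 1) * (j - 1)).negOnePow • bracket h' b a)
  jacobi {i j k ij ik jk n : ℤ} (hij : i + j = ij + 1) (hik : i + k = ik + 1)
    (hjk : j + k = jk + 1) (h₁ : i + jk = n + 1) (h₂ : ij + k = n + 1) (h₃ : j + ik = n + 1)
    (a : A i) (b : A j) (c : A k) :
    bracket h₁ a (bracket hjk b c) = bracket h₂ (bracket hij a b) c +
      ((i - 1) * (j - 1)).negOnePow • bracket h₃ b (bracket hik a c)
  leibniz {i j k ij ik jk n : ℤ} (hij : i + j = ij + 1) (hik : i + k = ik + 1)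
    (hjk : j + k = jk) (h₁ : i + jk = n + 1) (h₂ : ij + k = n) (h₃ : j + ik = n)
    (a : A i) (b : A j) (c : A k) :
    bracket h₁ a (mul hjk b c) = mul h₂ (bracket hij a b) c +
      ((i - 1) * j).negOnePow • mul h₃ b (bracket hik a c)

/-!
The cochains of a lax monoidal functor `F` form a nonsymmetric operad: the insertion of a natural
transformation `e` into a slot of another one, `c`. The structure morphism `μ` is an operation with
two inputs, which is associative and has the unit `η` by the axioms of a lax monoidal functor. The
product, the bracket and (up to a sign in degree zero) the differential are all given by insertions:
`c e = ± μ (c, e)`, the bracket is the commutator of the sum `c ∘ e` of all signed insertions, and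
`d = {μ, -}`. The theorem is therefore a case of a theorem of Gerstenhaber and Voronov on operads
with multiplication, which is proved here for a `SignedOperad`.

Let `x {y, z}` be the signed sum of all simultaneous insertions of `y` and `z` into `x`. The
relation `(x ∘ y) ∘ z = x ∘ (y ∘ z) + x {z, y} ± x {y, z}` (`circ_circ`) gives the Jacobi identity
and, as `μ ∘ μ = 0`, that `d` has square zero; so `d` is a derivation of the bracket. The two
expansions of `x {y, z} ∘ w` and `(x ∘ w) {y, z}` (`brace_circ`, `brace_circ_left`) show that `d` is
a derivation of the product. The remaining laws hold only up to homotopy: the coboundary of `x ∘ y`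
is the commutator of the cocycles `x` and `y` (`δ_circ`), and that of `x {y, z}` is the defect of
the derivation law (`leibniz_homotopy`).

The operad axioms for cochains (`Cochain.comp_assoc`, `Cochain.comp_comm`) need care with the
canonical isomorphisms and with the arithmetic of arities. Both are handled by evaluating cochains
on words, that is, lists of objects, rather than on families indexed by `Fin n`: the description
`Cochain.eval_comp` of an insertion reduces the axioms to identities between morphisms
`wordApply`, which are proved by induction on a word.
-/

/-! ### Operads with signed insertions and the brace relations -/

namespace MonoidalHochschild

/-- The Koszul sign `(-1) ^ ((j - 1) (k - 1))` of operations with `j` and `k` inputs, whose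
degrees are shifted by one. -/
def koszul (j k : ℕ) : ℤ := ((((j : ℤ) - 1) * ((k : ℤ) - 1)).negOnePow : ℤˣ)

/-- A nonsymmetric operad of abelian groups with a strictly associative and unital multiplication.
All the operations lie in one group `G`, those with `n` inputs in the subgroup `H n`, so that no
equations between arities are needed. The map `ins p x y` is `(-1) ^ ((j - 1) p)` times the
insertion of `y`, with `j` inputs, into the slot number `p + 1` of `x`; with this normalization the
signs in the two operad axioms `ins_ins` and `ins_comm` are those of the Koszul rule. -/
structure SignedOperad (G : Type*) [AddCommGroup G] where
  /-- The operations with `n` inputs. -/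
  H : ℕ → AddSubgroup G
  /-- The signed insertion into the slot number `p + 1`. -/
  ins : ℕ → G →+ G →+ G
  ins_mem {i j p : ℕ} {x y : G} : x ∈ H (i + 1) → y ∈ H j → p ≤ i → ins p x y ∈ H (i + j)
  ins_ins {i j k p q : ℕ} {x y z : G} : x ∈ H i → y ∈ H j → z ∈ H k → p < i → q < j →
    ins (p + q) (ins p x y) z = ins p x (ins q y z)
  ins_comm {i j k p q : ℕ} {x y z : G} : x ∈ H i → y ∈ H j → z ∈ H k → p ≤ q → q + 1 < i →
    ins (q + j) (ins p x y) z = koszul j k • ins p (ins (q + 1) x z) y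
  /-- The identity operation. -/
  id : G
  /-- The multiplication. -/
  mul : G
  /-- The unit of the multiplication. -/
  unit : G
  id_mem : id ∈ H 1
  mul_mem : mul ∈ H 2
  unit_mem : unit ∈ H 0
  ins_id {k : ℕ} {x : G} : x ∈ H k → ins 0 id x = x
  mul_assoc : ins 1 mul mul = -ins 0 mul mul
  mul_unit : ins 1 mul unit = -id
  unit_mul : ins 0 mul unit = id

namespace SignedOperad

variable {G : Type*} [AddCommGroup G] (O : SignedOperad G)

/-- The part of `circ` with the insertions into the slots `a + 1, …, b`. -/
def window (a b : ℕ) : G →+ G →+ G := ∑ p ∈ Finset.Ico a b, O.ins p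

/-- The sum `x ∘ y` of all signed insertions of `y` into `x`, where `x` has `i` inputs. -/
def circ (i : ℕ) : G →+ G →+ G := ∑ p ∈ Finset.range i, O.ins p

/-- The brace `x {y, z}`: the sum of all signed insertions of `y` and `z` into `x`, where `y` is
to the left of `z` and `x` has `i` inputs. -/
def brace (i : ℕ) (x y z : G) : G := ∑ q ∈ Finset.range i, O.circ q (O.ins q x z) y

/-- The brace `x {y, z, w}` with three insertions, where `x` has `i` inputs. -/
def brace₃ (i : ℕ) (x y z w : G) : G := ∑ r ∈ Finset.range i, O.brace r (O.ins r x w) y z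

theorem circ_apply (i : ℕ) (x y : G) : O.circ i x y = ∑ p ∈ Finset.range i, O.ins p x y := by
  simp [circ]

theorem window_apply (a b : ℕ) (x y : G) :
    O.window a b x y = ∑ p ∈ Finset.Ico a b, O.ins p x y := by
  simp [window]

theorem window_zero (b : ℕ) : O.window 0 b = O.circ b := by
  rw [window, circ, Finset.range_eq_Ico]

variable {O}

theorem ins_mem' {i j n p : ℕ} {x y : G} (hx : x ∈ O.H i) (hy : y ∈ O.H j) (hp : p < i)
    (hn : i + j = n + 1) : O.ins p x y ∈ O.H n := by
  obtain ⟨i, rfl⟩ : ∃ i', i = i' + 1 := ⟨i - 1, by omega⟩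
  obtain rfl : n = i + j := by omega
  exact O.ins_mem hx hy (by omega)

theorem circ_mem {i j n : ℕ} {x y : G} (hx : x ∈ O.H i) (hy : y ∈ O.H j) (hn : i + j = n + 1) :
    O.circ i x y ∈ O.H n := by
  rw [circ_apply]
  exact sum_mem fun p hp => ins_mem' hx hy (Finset.mem_range.1 hp) hn

theorem brace_mem {i j k n : ℕ} {x y z : G} (hx : x ∈ O.H i) (hy : y ∈ O.H j) (hz : z ∈ O.H k)
    (hn : i + j + k = n + 2) : O.brace i x y z ∈ O.H n := by
  refine sum_mem fun q hq => ?_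
  rw [Finset.mem_range] at hq
  rw [circ_apply]
  refine sum_mem fun p hp => ?_
  rw [Finset.mem_range] at hp
  exact ins_mem' (i := i + k - 1) (ins_mem' hx hz hq (by omega)) hy (by omega) (by omega)

/-- A sum over slots, split at a block of `j` slots that starts at `p`. -/
theorem sum_Ico_split {M : Type*} [AddCommMonoid M] (f : ℕ → M) {a p h : ℕ} (j : ℕ)
    (ha : a ≤ p) (hp : p ≤ h) : ∑ r ∈ Finset.Ico a (h + j), f r =
      ∑ r ∈ Finset.Ico a p, f r + ∑ t ∈ Finset.range j, f (p + t) +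
        ∑ q ∈ Finset.Ico p h, f (q + j) := by
  rw [← Finset.sum_Ico_consecutive f ha (show p ≤ h + j by omega),
    ← Finset.sum_Ico_consecutive f (show p ≤ p + j by omega) (show p + j ≤ h + j by omega),
    Finset.sum_Ico_eq_sum_range f p (p + j), Finset.sum_Ico_add' f p h j]
  simp [add_assoc]

theorem sum_triangle {M : Type*} [AddCommMonoid M] (f : ℕ → ℕ → M) (i : ℕ) :
    ∑ p ∈ Finset.range i, ∑ q ∈ Finset.Ico (p + 1) i, f p q =
      ∑ q ∈ Finset.range i, ∑ p ∈ Finset.range q, f p q :=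
  Finset.sum_comm' (by intro a b; simp only [Finset.mem_range, Finset.mem_Ico]; omega)

/-- Inserting `z` into `x ∘_p y`: to the left of `y`, into `y`, or to the right of `y`. -/
theorem window_ins {a h i j k p : ℕ} {x y z : G} (hx : x ∈ O.H i) (hy : y ∈ O.H j)
    (hz : z ∈ O.H k) (ha : a ≤ p) (hp : p ≤ h) (hi : h < i) :
    O.window a (h + j) (O.ins p x y) z = O.window a p (O.ins p x y) z +
      O.ins p x (O.circ j y z) + koszul j k • O.ins p (O.window (p + 1) (h + 1) x z) y := by
  simp only [window_apply, circ_apply]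
  rw [sum_Ico_split _ j ha hp]
  congr 1
  · congr 1
    rw [map_sum]
    refine Finset.sum_congr rfl fun t ht => ?_
    exact O.ins_ins hx hy hz (by omega) (Finset.mem_range.1 ht)
  · rw [map_sum, AddMonoidHom.finsetSum_apply, Finset.smul_sum,
      ← Finset.sum_Ico_add' (fun q => koszul j k • O.ins p (O.ins q x z) y) p h 1]
    refine Finset.sum_congr rfl fun q hq => ?_
    rw [Finset.mem_Ico] at hq
    exact O.ins_comm hx hy hz hq.1 (by omega)

theorem sum_ins_window (i : ℕ) (x y z : G) :
    ∑ p ∈ Finset.range i, O.ins p (O.window (p + 1) i x z) y = O.brace i x y z := by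
  simp only [window_apply, map_sum, AddMonoidHom.finsetSum_apply, brace, circ_apply]
  exact sum_triangle (fun p q => O.ins p (O.ins q x z) y) i

/-- The pre-Lie relation `(x ∘ y) ∘ z = x ∘ (y ∘ z) + x {z, y} ± x {y, z}`. -/
theorem circ_circ {i j k n : ℕ} {x y z : G} (hx : x ∈ O.H i) (hy : y ∈ O.H j) (hz : z ∈ O.H k)
    (hn : n = i + j - 1) :
    O.circ n (O.circ i x y) z = O.circ i x (O.circ j y z) + O.brace i x z y +
      koszul j k • O.brace i x y z := by
  subst hn
  rcases i with _ | i
  · simp [circ, brace]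
  have key : ∀ p ∈ Finset.range (i + 1), O.circ (i + 1 + j - 1) (O.ins p x y) z =
      O.circ p (O.ins p x y) z + O.ins p x (O.circ j y z) +
        koszul j k • O.ins p (O.window (p + 1) (i + 1) x z) y := fun p hp => by
    rw [Finset.mem_range] at hp
    rw [show i + 1 + j - 1 = i + j by omega, ← window_zero,
      window_ins hx hy hz (Nat.zero_le p) (by omega) (Nat.lt_succ_self i), window_zero]
  rw [circ_apply O (i + 1) x y, map_sum, AddMonoidHom.finsetSum_apply, Finset.sum_congr rfl key,
    Finset.sum_add_distrib, Finset.sum_add_distrib, ← Finset.smul_sum, sum_ins_window,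
    ← circ_apply]
  simp only [brace]
  abel

/-- The brace relation that expands `x {b, c} ∘ y`. -/
theorem brace_circ {i j k l n : ℕ} {x b c y : G} (hx : x ∈ O.H i) (hb : b ∈ O.H j)
    (hc : c ∈ O.H k) (hy : y ∈ O.H l) (hn : n = i + j + k - 2) :
    O.circ n (O.brace i x b c) y = O.brace₃ i x y b c + O.brace i x (O.circ j b y) c +
      koszul j l • (O.brace₃ i x b y c + O.brace i x b (O.circ k c y) +
        koszul k l • O.brace₃ i x b c y) := by
  subst hn
  rcases i with _ | _ | i
  · simp [brace, brace₃]
  · simp [brace, brace₃, circ]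
  have key : ∀ q ∈ Finset.range (i + 2), ∀ p ∈ Finset.range q,
      O.circ (i + 2 + j + k - 2) (O.ins p (O.ins q x c) b) y =
      O.circ p (O.ins p (O.ins q x c) b) y + O.ins p (O.ins q x c) (O.circ j b y) +
        koszul j l • (O.ins p (O.window (p + 1) q (O.ins q x c) y) b +
          O.ins p (O.ins q x (O.circ k c y)) b +
          koszul k l • O.ins p (O.ins q (O.window (q + 1) (i + 2) x y) c) b) := by
    intro q hq p hp
    rw [Finset.mem_range] at hp hq
    have hX : O.ins q x c ∈ O.H (i + 1 + k) := O.ins_mem hx hc (by omega)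
    rw [show i + 2 + j + k - 2 = i + k + j by omega, ← window_zero,
      window_ins hX hb hy (Nat.zero_le p) (by omega) (by omega), window_zero,
      show i + k + 1 = i + 1 + k by omega,
      window_ins hx hc hy (show p + 1 ≤ q by omega) (by omega) (by omega)]
    simp only [map_add, map_zsmul, AddMonoidHom.add_apply, AddMonoidHom.smul_apply]
  have e₁ : O.brace (i + 2) x b c =
      ∑ q ∈ Finset.range (i + 2), ∑ p ∈ Finset.range q, O.ins p (O.ins q x c) b := by
    simp only [brace, circ_apply]
  rw [e₁]
  simp only [map_sum, AddMonoidHom.finsetSum_apply]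
  rw [Finset.sum_congr rfl fun q hq => Finset.sum_congr rfl (key q hq)]
  simp only [Finset.sum_add_distrib, ← Finset.smul_sum, sum_ins_window]
  have e₂ : ∑ q ∈ Finset.range (i + 2), ∑ p ∈ Finset.range q,
      O.ins p (O.ins q (O.window (q + 1) (i + 2) x y) c) b = O.brace₃ (i + 2) x b c y := by
    simp only [brace₃, brace]
    rw [← sum_triangle (fun q s => O.circ q (O.ins q (O.ins s x y) c) b)]
    refine Finset.sum_congr rfl fun q _ => ?_
    rw [← circ_apply]
    simp only [window_apply, map_sum, AddMonoidHom.finsetSum_apply]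
  rw [e₂]
  simp only [brace₃, brace, circ_apply]

/-- The brace relation that expands `(x ∘ y) {b, c}`. -/
theorem brace_circ_left {i j k l n : ℕ} {x b c y : G} (hx : x ∈ O.H i) (hb : b ∈ O.H j)
    (hc : c ∈ O.H k) (hy : y ∈ O.H l) (hn : n = i + l - 1) :
    O.brace n (O.circ i x y) b c = O.circ i x (O.brace l y b c) + O.brace i x b (O.circ l y c) +
      O.brace₃ i x b c y + koszul l k • (O.brace₃ i x b y c + O.brace i x (O.circ l y b) c +
        koszul l j • O.brace₃ i x y b c) := by
  subst hn
  rcases i with _ | i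
  · simp [brace, brace₃, circ]
  -- `c` enters `y`
  have inner : ∀ s ∈ Finset.range (i + 1), ∀ t ∈ Finset.range l,
      O.circ (s + t) (O.ins (s + t) (O.ins s x y) c) b =
        O.circ s (O.ins s x (O.ins t y c)) b + O.ins s x (O.circ t (O.ins t y c) b) := by
    intro s hs t ht
    rw [Finset.mem_range] at hs ht
    have hY : O.ins t y c ∈ O.H (l + k - 1) := ins_mem' hy hc ht (by omega)
    rw [O.ins_ins hx hy hc hs ht]
    simp only [circ_apply, map_sum]
    rw [Finset.sum_range_add]
    congr 1
    refine Finset.sum_congr rfl fun t' ht' => ?_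
    rw [Finset.mem_range] at ht'
    exact O.ins_ins hx hY hb hs (by omega)
  -- `c` is to the right of `y`
  have outer : ∀ s ∈ Finset.range (i + 1), ∀ q ∈ Finset.Ico s i,
      O.circ (q + l) (O.ins (q + l) (O.ins s x y) c) b =
        koszul l k • (O.circ s (O.ins s (O.ins (q + 1) x c) y) b +
          O.ins s (O.ins (q + 1) x c) (O.circ l y b) +
          koszul l j • O.ins s (O.window (s + 1) (q + 1) (O.ins (q + 1) x c) b) y) := by
    intro s hs q hq
    rw [Finset.mem_Ico] at hq
    have hX : O.ins (q + 1) x c ∈ O.H (i + k) := O.ins_mem hx hc (by omega)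
    rw [O.ins_comm hx hy hc hq.1 (by omega), map_zsmul, AddMonoidHom.smul_apply, ← window_zero,
      window_ins hX hy hb (Nat.zero_le s) hq.1 (by omega), window_zero]
  have key : ∀ s ∈ Finset.range (i + 1), O.brace (i + 1 + l - 1) (O.ins s x y) b c =
      O.brace s (O.ins s x y) b c + (O.circ s (O.ins s x (O.circ l y c)) b +
        O.ins s x (O.brace l y b c)) +
      ∑ q ∈ Finset.Ico (s + 1) (i + 1), koszul l k • (O.circ s (O.ins s (O.ins q x c) y) b +
          O.ins s (O.ins q x c) (O.circ l y b) +
          koszul l j • O.ins s (O.window (s + 1) q (O.ins q x c) b) y) := by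
    intro s hs
    have hs' := Finset.mem_range.1 hs
    rw [show i + 1 + l - 1 = i + l by omega, brace, Finset.range_eq_Ico,
      sum_Ico_split _ l (Nat.zero_le s) (show s ≤ i by omega),
      Finset.sum_congr rfl (inner s hs), Finset.sum_congr rfl (outer s hs),
      Finset.sum_Ico_add' (fun q => koszul l k • (O.circ s (O.ins s (O.ins q x c) y) b +
          O.ins s (O.ins q x c) (O.circ l y b) +
          koszul l j • O.ins s (O.window (s + 1) q (O.ins q x c) b) y)) s i 1,
      Finset.sum_add_distrib, ← Finset.range_eq_Ico]
    simp only [brace, circ_apply O l, map_sum, AddMonoidHom.finsetSum_apply]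
  have e₁ : O.brace (i + 1 + l - 1) (O.circ (i + 1) x y) b c =
      ∑ s ∈ Finset.range (i + 1), O.brace (i + 1 + l - 1) (O.ins s x y) b c := by
    simp only [brace, circ_apply O (i + 1), map_sum, AddMonoidHom.finsetSum_apply]
    exact Finset.sum_comm
  rw [e₁, Finset.sum_congr rfl key, Finset.sum_add_distrib, Finset.sum_add_distrib,
    Finset.sum_add_distrib, sum_triangle]
  simp only [← Finset.smul_sum, Finset.sum_add_distrib, sum_ins_window]
  simp only [brace₃, circ_apply O (i + 1)]
  simp only [brace, circ_apply]
  abel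

end SignedOperad
end MonoidalHochschild

/-! ### The differential, the product and the bracket of an operad with multiplication -/

namespace MonoidalHochschild

theorem negOnePow_smul_eq_ite {G : Type*} [AddCommGroup G] (n : ℤ) (x : G) :
    n.negOnePow • x = if Even n then x else -x := by
  split_ifs with h
  · rw [Int.negOnePow_even n h, one_smul]
  · rw [Int.negOnePow_odd n (Int.not_even_iff_odd.1 h), Units.neg_smul, one_smul]

theorem koszul_smul_eq_ite {G : Type*} [AddCommGroup G] (j k : ℕ) (x : G) :
    koszul j k • x = if Even (((j : ℤ) - 1) * ((k : ℤ) - 1)) then x else -x :=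
  negOnePow_smul_eq_ite _ x

-- All the sign checks below use one list of parity lemmas.
set_option linter.unusedSimpArgs false
namespace SignedOperad

variable {G : Type*} [AddCommGroup G] (O : SignedOperad G)

/-- The bracket `x ∘ y - (-1) ^ ((i + 1) (j + 1)) y ∘ x` of elements with `i` and `j` inputs. The
degrees are integers, and a negative one is read as zero. -/
def lie (i j : ℤ) (x y : G) : G :=
  O.circ i.toNat x y - ((i + 1) * (j + 1)).negOnePow • O.circ j.toNat y x

/-- The bracket with the multiplication, as a differential. -/
def δ (i : ℕ) (x : G) : G := O.lie 2 i O.mul x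

/-- The product `(-1) ^ (i j) m (x, y)`. The remaining sign `(-1) ^ (j - 1)` cancels the one in
the signed insertion `ins 1 mul y`. -/
def cup (i j : ℤ) (x y : G) : G :=
  (i * j + j - 1).negOnePow • O.ins 0 (O.ins 1 O.mul y) x

variable {O}

/-- By the pre-Lie relation both sides are sums of the same braces. -/
theorem jacobi {i j k : ℕ} {x y z : G} (hx : x ∈ O.H i) (hy : y ∈ O.H j) (hz : z ∈ O.H k) :
    O.lie i (j + k - 1) x (O.lie j k y z) = O.lie (i + j - 1) k (O.lie i j x y) z +
      (((i : ℤ) - 1) * ((j : ℤ) - 1)).negOnePow • O.lie j (i + k - 1) y (O.lie i k x z) := by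
  have e (a b : ℕ) : ((a : ℤ) + b - 1).toNat = a + b - 1 := by omega
  simp only [lie, e, Int.toNat_natCast, map_sub, AddMonoidHom.sub_apply, Units.smul_def, map_zsmul,
    AddMonoidHom.smul_apply,
    circ_circ hx hy hz rfl, circ_circ hy hx hz (show i + j - 1 = j + i - 1 by omega),
    circ_circ hx hz hy rfl, circ_circ hz hx hy (show i + k - 1 = k + i - 1 by omega),
    circ_circ hy hz hx rfl, circ_circ hz hy hx (show j + k - 1 = k + j - 1 by omega)]
  simp only [← Units.smul_def, negOnePow_smul_eq_ite, koszul_smul_eq_ite]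
  by_cases hi : Even i <;> by_cases hj : Even j <;> by_cases hk : Even k <;>
    simp only [Int.even_mul, Int.even_add, Int.even_sub, Int.even_coe_nat, Int.not_even_one, even_two,
      hi, hj, hk, iff_true, iff_false, iff_self, not_true, not_false_iff, or_true, or_false, or_self, true_or,
      if_true, if_false, neg_neg, neg_add, neg_sub, sub_neg_eq_add] <;> abel

theorem circ_mul_mul : O.circ 2 O.mul O.mul = 0 := by
  simp [circ_apply, Finset.sum_range_succ, O.mul_assoc]

/-- There is no room for three insertions into an operation with two inputs. -/
theorem brace₃_two (x y z w : G) : O.brace₃ 2 x y z w = 0 := by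
  simp [brace₃, brace, Finset.sum_range_succ, circ]

theorem brace_two (x y z : G) : O.brace 2 x y z = O.ins 0 (O.ins 1 x z) y := by
  simp [brace, Finset.sum_range_succ, circ]

theorem δ_eq (i : ℕ) (x : G) :
    O.δ i x = O.circ 2 O.mul x - ((i : ℤ) + 1).negOnePow • O.circ i x O.mul := by
  simp only [δ, lie, negOnePow_smul_eq_ite]
  rw [show ((2 : ℤ) + 1) * (i + 1) = i + 1 + 2 * (i + 1) by ring]
  simp [Int.even_add (m := (i : ℤ) + 1)]

/-- This is the pre-Lie relation with `m ∘ m = 0`. The Jacobi identity alone would give only twice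
the claim. -/
theorem δ_δ {i : ℕ} {x : G} (hx : x ∈ O.H i) : O.δ (i + 1) (O.δ i x) = 0 := by
  have h := circ_circ O.mul_mem O.mul_mem hx (show 3 = 2 + 2 - 1 by omega)
  simp only [δ_eq, Nat.cast_add, Nat.cast_one, map_sub, AddMonoidHom.sub_apply, Units.smul_def,
    map_zsmul, AddMonoidHom.smul_apply,
    circ_circ O.mul_mem hx O.mul_mem (show i + 1 = 2 + i - 1 by omega),
    circ_circ hx O.mul_mem O.mul_mem (show i + 1 = i + 2 - 1 by omega), circ_mul_mul, map_zero,
    AddMonoidHom.zero_apply] at h ⊢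
  simp only [← Units.smul_def, negOnePow_smul_eq_ite, koszul_smul_eq_ite, Nat.cast_ofNat] at h ⊢
  by_cases hi : Even i <;> (
    simp only [Int.even_mul, Int.even_add, Int.even_sub, Int.even_coe_nat, Int.not_even_one,
      even_two, hi, iff_true, iff_false, iff_self, not_true, not_false_iff, or_true, or_false,
      or_self, true_or, if_true, if_false, neg_neg, neg_add, neg_sub, sub_neg_eq_add] at h ⊢
    linear_combination (norm := abel1) -h)

variable (O) in
theorem brace_sub_middle (i : ℕ) (x y y' z : G) :
    O.brace i x (y - y') z = O.brace i x y z - O.brace i x y' z := by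
  simp [brace]

variable (O) in
theorem brace_sub_right (i : ℕ) (x y z z' : G) :
    O.brace i x y (z - z') = O.brace i x y z - O.brace i x y z' := by
  simp [brace]

variable (O) in
theorem brace_zsmul_left (i : ℕ) (n : ℤ) (x y z : G) :
    O.brace i (n • x) y z = n • O.brace i x y z := by
  simp [brace, Finset.smul_sum]

variable (O) in
theorem brace_zsmul_middle (i : ℕ) (n : ℤ) (x y z : G) :
    O.brace i x (n • y) z = n • O.brace i x y z := by
  simp [brace, Finset.smul_sum]

variable (O) in
theorem brace_zsmul_right (i : ℕ) (n : ℤ) (x y z : G) :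
    O.brace i x y (n • z) = n • O.brace i x y z := by
  simp [brace, Finset.smul_sum]

/-- `δ` is a derivation of the multiplication, up to signs. -/
theorem δ_brace_mul {i j : ℕ} {x y : G} (hx : x ∈ O.H i) (hy : y ∈ O.H j) :
    O.δ (i + j) (O.brace 2 O.mul x y) =
      (j : ℤ).negOnePow • O.brace 2 O.mul (O.δ i x) y - O.brace 2 O.mul x (O.δ j y) := by
  have h := brace_circ_left O.mul_mem hx hy O.mul_mem (show 3 = 2 + 2 - 1 by omega)
  have h₀ : O.brace 3 0 x y = 0 := by simp [brace]
  simp only [δ_eq, Nat.cast_add, Units.smul_def, brace_sub_middle, brace_sub_right,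
    brace_zsmul_middle, brace_zsmul_right, circ_mul_mul, brace₃_two, h₀,
    brace_circ O.mul_mem hx hy O.mul_mem (show i + j = 2 + i + j - 2 by omega)] at h ⊢
  simp only [← Units.smul_def, negOnePow_smul_eq_ite, koszul_smul_eq_ite, Nat.cast_ofNat] at h ⊢
  by_cases hi : Even i <;> by_cases hj : Even j <;> (
    simp only [Int.even_mul, Int.even_add, Int.even_sub, Int.even_coe_nat, Int.not_even_one,
      even_two, hi, hj, iff_true, iff_false, iff_self, not_true, not_false_iff, or_true, or_false,
      or_self, true_or, if_true, if_false, neg_neg, neg_add, neg_sub, sub_neg_eq_add] at h ⊢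
    linear_combination (norm := abel1) -h)

/-- The coboundary of `x ∘ y`: for cocycles `x` and `y` it is the graded commutator of the
multiplication. -/
theorem δ_circ {i j : ℕ} {x y : G} (hx : x ∈ O.H i) (hy : y ∈ O.H j) :
    O.lie 2 (i + j - 1) O.mul (O.circ i x y) = O.circ (i + 1) (O.δ i x) y +
      ((i : ℤ) - 1).negOnePow • O.circ i x (O.δ j y) - O.brace 2 O.mul y x -
      koszul i j • O.brace 2 O.mul x y := by
  have e : ((i : ℤ) + j - 1).toNat = i + j - 1 := by omega
  have e₂ : (2 : ℤ).toNat = 2 := rfl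
  simp only [lie, δ_eq, e, map_sub, AddMonoidHom.sub_apply, Units.smul_def,
    map_zsmul, AddMonoidHom.smul_apply, circ_circ hx hy O.mul_mem rfl,
    circ_circ O.mul_mem hx hy (show i + 1 = 2 + i - 1 by omega),
    circ_circ hx O.mul_mem hy (show i + 1 = i + 2 - 1 by omega), e₂]
  simp only [← Units.smul_def, negOnePow_smul_eq_ite, koszul_smul_eq_ite, Nat.cast_ofNat]
  by_cases hi : Even i <;> by_cases hj : Even j <;> (
    simp only [Int.even_mul, Int.even_add, Int.even_sub, Int.even_coe_nat, Int.not_even_one,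
      even_two, hi, hj, iff_true, iff_false, iff_self, not_true, not_false_iff, or_true, or_false,
      or_self, true_or, if_true, if_false, neg_neg, neg_add, neg_sub, sub_neg_eq_add]
    abel)

/-- For cocycles, the failure of the bracket to be a derivation of the product is the coboundary of
`x {y, z}`. -/
theorem leibniz_homotopy {i j k : ℕ} {x y z : G} (hx : x ∈ O.H i) (hy : y ∈ O.H j)
    (hz : z ∈ O.H k) (hδx : O.δ i x = 0) (hδy : O.δ j y = 0) (hδz : O.δ k z = 0) :
    O.lie i (j + k) x (O.cup j k y z) = O.cup (i + j - 1) k (O.lie i j x y) z +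
      (((i : ℤ) - 1) * j).negOnePow • O.cup j (i + k - 1) y (O.lie i k x z) +
      ((j : ℤ) * k + k + i).negOnePow • O.lie 2 (i + j + k - 2) O.mul (O.brace i x y z) := by
  have e : ((i : ℤ) + j + k - 2).toNat = i + j + k - 2 := by omega
  have e₂ : (2 : ℤ).toNat = 2 := rfl
  have e' : ((j : ℤ) + k).toNat = j + k := by omega
  rw [δ_eq, sub_eq_zero] at hδx hδy hδz
  -- the cocycle condition for `x` enters through `(δ x) {y, z} = 0`
  have h₁ := brace_circ_left O.mul_mem hy hz hx (show i + 1 = 2 + i - 1 by omega)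
  have h₂ := brace_circ_left hx hy hz O.mul_mem (show i + 1 = i + 2 - 1 by omega)
  rw [hδx, Units.smul_def, brace_zsmul_left] at h₁
  simp only [lie, cup, ← brace_two, e, e', map_sub, AddMonoidHom.sub_apply, Units.smul_def,
    map_zsmul, AddMonoidHom.smul_apply, brace_sub_middle, brace_sub_right,
    brace_zsmul_middle, brace_zsmul_right, brace₃_two,
    brace_circ O.mul_mem hy hz hx (show j + k = 2 + j + k - 2 by omega),
    brace_circ hx hy hz O.mul_mem rfl, e₂, Int.toNat_natCast, hδy, hδz] at h₁ h₂ ⊢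
  simp only [← Units.smul_def, negOnePow_smul_eq_ite, koszul_smul_eq_ite, Nat.cast_ofNat] at h₁ h₂ ⊢
  by_cases hi : Even i <;> by_cases hj : Even j <;> by_cases hk : Even k
  all_goals
    simp only [Int.even_mul, Int.even_add, Int.even_sub, Int.even_coe_nat, Int.not_even_one,
      even_two, hi, hj, hk, iff_true, iff_false, iff_self, not_true, not_false_iff, or_true, or_false,
      or_self, true_or, if_true, if_false, neg_neg, neg_add, neg_sub, sub_neg_eq_add] at h₁ h₂ ⊢
    first
    | linear_combination (norm := abel1) h₁ + h₂
    | linear_combination (norm := abel1) h₁ - h₂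
    | linear_combination (norm := abel1) -h₁ + h₂
    | linear_combination (norm := abel1) -h₁ - h₂

end SignedOperad
end MonoidalHochschild

/-! ### Cohomology of an operad with multiplication -/

namespace MonoidalHochschild
set_option linter.unusedSimpArgs false
namespace SignedOperad

variable {G : Type*} [AddCommGroup G] (O : SignedOperad G)

/-- The grading `H`, extended by zero to negative degrees. -/
def gr (n : ℤ) : AddSubgroup G := if 0 ≤ n then O.H n.toNat else ⊥

theorem gr_natCast (n : ℕ) : O.gr n = O.H n := by simp [gr]

/-- The bracket as a biadditive map. -/
def lieHom (i j : ℤ) : G →+ G →+ G :=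
  O.circ i.toNat - ((i + 1) * (j + 1)).negOnePow • (O.circ j.toNat).flip

theorem lieHom_apply (i j : ℤ) (x y : G) : O.lieHom i j x y = O.lie i j x y := rfl

/-- The product as a biadditive map. -/
def cupHom (i j : ℤ) : G →+ G →+ G :=
  (i * j + j - 1).negOnePow • ((O.ins 0).comp (O.ins 1 O.mul)).flip

/-- The differential in integer degrees. -/
def diff (n : ℤ) : G →+ G := O.lieHom 2 n O.mul

theorem diff_natCast (n : ℕ) (x : G) : O.diff n x = O.δ n x := rfl

/-- The cocycles. -/
def Z (n : ℤ) : AddSubgroup G := O.gr n ⊓ (O.diff n).ker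

/-- The coboundaries. -/
def Bd (n : ℤ) : AddSubgroup G := (O.gr (n - 1)).map (O.diff (n - 1))

variable {O}

theorem mem_Z {n : ℤ} {x : G} : x ∈ O.Z n ↔ x ∈ O.gr n ∧ O.diff n x = 0 := Iff.rfl

theorem eq_zero_or_of_mem_gr {n : ℤ} {x : G} (hx : x ∈ O.gr n) :
    x = 0 ∨ ∃ m : ℕ, n = m ∧ x ∈ O.H m := by
  rw [gr] at hx
  split_ifs at hx with h
  · exact Or.inr ⟨n.toNat, by omega, hx⟩
  · exact Or.inl hx

theorem mem_gr_of_mem_H {n : ℤ} {m : ℕ} {x : G} (hx : x ∈ O.H m) (h : n = m) : x ∈ O.gr n := by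
  rwa [h, gr_natCast]

theorem circ_mem_gr {i j : ℤ} {x y : G} (hx : x ∈ O.gr i) (hy : y ∈ O.gr j) :
    O.circ i.toNat x y ∈ O.gr (i + j - 1) := by
  obtain rfl | ⟨i, rfl, hx'⟩ := eq_zero_or_of_mem_gr hx
  · simp
  obtain rfl | ⟨j, rfl, hy'⟩ := eq_zero_or_of_mem_gr hy
  · simp
  rcases i with _ | i
  · simp [circ]
  · exact mem_gr_of_mem_H (circ_mem hx' hy' (n := i + j) (by omega)) (by push_cast; ring)

theorem brace_mem_gr {i j k : ℤ} {x y z : G} (hx : x ∈ O.gr i) (hy : y ∈ O.gr j)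
    (hz : z ∈ O.gr k) : O.brace i.toNat x y z ∈ O.gr (i + j + k - 2) := by
  obtain rfl | ⟨i, rfl, hx'⟩ := eq_zero_or_of_mem_gr hx
  · simp [brace]
  obtain rfl | ⟨j, rfl, hy'⟩ := eq_zero_or_of_mem_gr hy
  · simp [brace]
  obtain rfl | ⟨k, rfl, hz'⟩ := eq_zero_or_of_mem_gr hz
  · simp [brace]
  rcases i with _ | _ | i
  · simp [brace]
  · simp [brace, circ]
  · exact mem_gr_of_mem_H (brace_mem hx' hy' hz' (n := i + j + k) (by omega)) (by push_cast; ring)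

theorem lie_mem_gr {i j : ℤ} {x y : G} (hx : x ∈ O.gr i) (hy : y ∈ O.gr j) :
    O.lie i j x y ∈ O.gr (i + j - 1) :=
  sub_mem (circ_mem_gr hx hy) (zsmul_mem (add_comm j i ▸ circ_mem_gr hy hx) _)

theorem mul_mem_gr : O.mul ∈ O.gr 2 := mem_gr_of_mem_H O.mul_mem rfl

theorem cup_eq_brace (i j : ℤ) (x y : G) :
    O.cup i j x y = (i * j + j - 1).negOnePow • O.brace 2 O.mul x y := by
  rw [cup, brace_two]

theorem cup_mem_gr {i j : ℤ} {x y : G} (hx : x ∈ O.gr i) (hy : y ∈ O.gr j) :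
    O.cup i j x y ∈ O.gr (i + j) := by
  rw [cup_eq_brace, show i + j = 2 + i + j - 2 by ring]
  exact zsmul_mem (brace_mem_gr mul_mem_gr hx hy) _

theorem diff_mem_gr {n : ℤ} {x : G} (hx : x ∈ O.gr n) : O.diff n x ∈ O.gr (n + 1) := by
  rw [show n + 1 = 2 + n - 1 by ring]
  exact lie_mem_gr mul_mem_gr hx

theorem diff_diff {n : ℤ} {x : G} (hx : x ∈ O.gr n) : O.diff (n + 1) (O.diff n x) = 0 := by
  obtain rfl | ⟨n, rfl, hx'⟩ := eq_zero_or_of_mem_gr hx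
  · simp
  · exact_mod_cast δ_δ hx'

theorem diff_mem_Bd {n : ℤ} {x : G} (hx : x ∈ O.gr (n - 1)) : O.diff (n - 1) x ∈ O.Bd n :=
  ⟨x, hx, rfl⟩

theorem Bd_le_Z (n : ℤ) : O.Bd n ≤ O.Z n := by
  rintro _ ⟨x, hx, rfl⟩
  exact ⟨by simpa using diff_mem_gr hx, by simpa using diff_diff hx⟩

theorem jacobi_int {i j k : ℤ} {x y z : G} (hx : x ∈ O.gr i) (hy : y ∈ O.gr j)
    (hz : z ∈ O.gr k) :
    O.lie i (j + k - 1) x (O.lie j k y z) = O.lie (i + j - 1) k (O.lie i j x y) z +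
      ((i - 1) * (j - 1)).negOnePow • O.lie j (i + k - 1) y (O.lie i k x z) := by
  obtain rfl | ⟨i, rfl, hx'⟩ := eq_zero_or_of_mem_gr hx
  · simp [lie]
  obtain rfl | ⟨j, rfl, hy'⟩ := eq_zero_or_of_mem_gr hy
  · simp [lie]
  obtain rfl | ⟨k, rfl, hz'⟩ := eq_zero_or_of_mem_gr hz
  · simp [lie]
  exact jacobi hx' hy' hz'

theorem diff_lie {i j : ℤ} {x y : G} (hx : x ∈ O.gr i) (hy : y ∈ O.gr j) :
    O.diff (i + j - 1) (O.lie i j x y) = O.lie (i + 1) j (O.diff i x) y +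
      (i - 1).negOnePow • O.lie i (j + 1) x (O.diff j y) := by
  have h := jacobi_int mul_mem_gr hx hy
  rw [show (2 : ℤ) + i - 1 = i + 1 by ring, show (2 : ℤ) + j - 1 = j + 1 by ring,
    show ((2 : ℤ) - 1) * (i - 1) = i - 1 by ring] at h
  exact h

theorem lie_antisymm (i j : ℤ) (x y : G) :
    O.lie i j x y = -(((i - 1) * (j - 1)).negOnePow • O.lie j i y x) := by
  simp only [lie, negOnePow_smul_eq_ite]
  by_cases hi : Even i <;> by_cases hj : Even j <;> (
    simp only [Int.even_mul, Int.even_add, Int.even_sub, Int.even_coe_nat, Int.not_even_one,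
      even_two, hi, hj, iff_true, iff_false, iff_self, not_true, not_false_iff, or_true, or_false,
      or_self, true_or, if_true, if_false, neg_neg, neg_add, neg_sub, sub_neg_eq_add]
    try abel)

theorem lie_mem_Z {i j : ℤ} {x y : G} (hx : x ∈ O.Z i) (hy : y ∈ O.Z j) :
    O.lie i j x y ∈ O.Z (i + j - 1) := by
  refine ⟨lie_mem_gr hx.1 hy.1, ?_⟩
  have h := diff_lie hx.1 hy.1
  rw [(mem_Z.1 hx).2, (mem_Z.1 hy).2] at h
  exact h.trans (by simp [lie])

theorem lie_mem_Bd_left {i j : ℤ} {x y : G} (hx : x ∈ O.Bd i) (hy : y ∈ O.Z j) :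
    O.lie i j x y ∈ O.Bd (i + j - 1) := by
  obtain ⟨x, hx, rfl⟩ := hx
  have h := diff_lie hx hy.1
  rw [(mem_Z.1 hy).2, show i - 1 + 1 = i by ring] at h
  have h' : O.lie i j (O.diff (i - 1) x) y =
      O.diff (i + j - 1 - 1) (O.lie (i - 1) j x y) := by
    rw [show i + j - 1 - 1 = i - 1 + j - 1 by ring, h]
    simp [lie]
  rw [h']
  refine diff_mem_Bd ?_
  rw [show i + j - 1 - 1 = i - 1 + j - 1 by ring]
  exact lie_mem_gr hx hy.1

theorem lie_mem_Bd_right {i j : ℤ} {x y : G} (hx : x ∈ O.Z i) (hy : y ∈ O.Bd j) :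
    O.lie i j x y ∈ O.Bd (i + j - 1) := by
  rw [lie_antisymm, add_comm i j]
  exact neg_mem (zsmul_mem (lie_mem_Bd_left hy hx) _)

theorem diff_brace_mul {i j : ℤ} {x y : G} (hx : x ∈ O.gr i) (hy : y ∈ O.gr j) :
    O.diff (i + j) (O.brace 2 O.mul x y) =
      j.negOnePow • O.brace 2 O.mul (O.diff i x) y - O.brace 2 O.mul x (O.diff j y) := by
  obtain rfl | ⟨i, rfl, hx'⟩ := eq_zero_or_of_mem_gr hx
  · simp [brace]
  obtain rfl | ⟨j, rfl, hy'⟩ := eq_zero_or_of_mem_gr hy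
  · simp [brace]
  exact_mod_cast δ_brace_mul hx' hy'

theorem diff_cup {i j : ℤ} {x y : G} (hx : x ∈ O.gr i) (hy : y ∈ O.gr j) :
    O.diff (i + j) (O.cup i j x y) = O.cup (i + 1) j (O.diff i x) y +
      i.negOnePow • O.cup i (j + 1) x (O.diff j y) := by
  have h := diff_brace_mul hx hy
  simp only [cup_eq_brace, Units.smul_def, map_zsmul, h]
  simp only [← Units.smul_def, negOnePow_smul_eq_ite]
  by_cases hi : Even i <;> by_cases hj : Even j <;> (
    simp only [Int.even_mul, Int.even_add, Int.even_sub, Int.even_coe_nat, Int.not_even_one,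
      even_two, hi, hj, iff_true, iff_false, iff_self, not_true, not_false_iff, or_true, or_false,
      or_self, true_or, if_true, if_false, neg_neg, neg_add, neg_sub, sub_neg_eq_add, neg_zero]
    abel)

theorem cup_mem_Z {i j : ℤ} {x y : G} (hx : x ∈ O.Z i) (hy : y ∈ O.Z j) :
    O.cup i j x y ∈ O.Z (i + j) := by
  refine ⟨cup_mem_gr hx.1 hy.1, (diff_cup hx.1 hy.1).trans ?_⟩
  rw [(mem_Z.1 hx).2, (mem_Z.1 hy).2]
  simp [cup]

theorem cup_mem_Bd_left {i j : ℤ} {x y : G} (hx : x ∈ O.Bd i) (hy : y ∈ O.Z j) :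
    O.cup i j x y ∈ O.Bd (i + j) := by
  obtain ⟨x, hx, rfl⟩ := hx
  have h := diff_cup hx hy.1
  rw [(mem_Z.1 hy).2, show i - 1 + 1 = i by ring] at h
  have h' : O.cup i j (O.diff (i - 1) x) y = O.diff (i + j - 1) (O.cup (i - 1) j x y) := by
    rw [show i + j - 1 = i - 1 + j by ring, h]
    simp [cup]
  rw [h']
  refine diff_mem_Bd ?_
  rw [show i + j - 1 = i - 1 + j by ring]
  exact cup_mem_gr hx hy.1

theorem cup_mem_Bd_right {i j : ℤ} {x y : G} (hx : x ∈ O.Z i) (hy : y ∈ O.Bd j) :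
    O.cup i j x y ∈ O.Bd (i + j) := by
  obtain ⟨y, hy, rfl⟩ := hy
  have h := diff_cup hx.1 hy
  rw [(mem_Z.1 hx).2, show j - 1 + 1 = j by ring] at h
  have h' : O.cup i j x (O.diff (j - 1) y) =
      i.negOnePow • O.diff (i + j - 1) (O.cup i (j - 1) x y) := by
    rw [show i + j - 1 = i + (j - 1) by ring, h, smul_add, smul_smul, ← Int.negOnePow_add]
    simp [cup, ← two_mul]
  rw [h']
  refine zsmul_mem (diff_mem_Bd ?_) _
  rw [show i + j - 1 = i + (j - 1) by ring]
  exact cup_mem_gr hx.1 hy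

/-- Both sides are, up to sign, the operation `x y z`; the multiplication is associative. -/
theorem ins_ins_mul {i j k : ℕ} {x y z : G} (hx : x ∈ O.H i) (hy : y ∈ O.H j) (hz : z ∈ O.H k) :
    O.ins 0 (O.ins 1 O.mul z) (O.ins 0 (O.ins 1 O.mul y) x) =
      (k : ℤ).negOnePow • O.ins 0 (O.ins 1 O.mul (O.ins 0 (O.ins 1 O.mul z) y)) x := by
  have hm := O.mul_mem
  have hmy : O.ins 1 O.mul y ∈ O.H (1 + j) := O.ins_mem hm hy le_rfl
  have hmz : O.ins 1 O.mul z ∈ O.H (1 + k) := O.ins_mem hm hz le_rfl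
  have hmm : O.ins 1 O.mul O.mul ∈ O.H (1 + 2) := O.ins_mem hm hm le_rfl
  have h₁ := O.ins_ins hmz hmy hx (p := 0) (q := 0) (by omega) (by omega)
  have h₂ := O.ins_comm hm hmy hz (le_refl 0) (by omega)
  have h₃ := O.ins_ins hm hm hy (p := 0) (q := 1) (by omega) (by omega)
  have h₄ := O.ins_ins hm hmz hy (p := 1) (q := 0) (by omega) (by omega)
  have h₅ := O.ins_ins hm hm hz (p := 1) (q := 1) (by omega) (by omega)
  have h₆ := O.ins_comm hmm hy hz (le_refl 1) (by omega)
  have h₇ : O.ins 0 O.mul O.mul = -O.ins 1 O.mul O.mul := by rw [O.mul_assoc, neg_neg]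
  rw [← h₁, ← h₄, ← h₅]
  rw [← h₃, h₇] at h₂
  simp only [map_neg, AddMonoidHom.neg_apply, zero_add, Nat.reduceAdd, add_zero, h₆] at h₂ ⊢
  simp only [koszul_smul_eq_ite, negOnePow_smul_eq_ite, Nat.cast_add, Nat.cast_one] at h₂ ⊢
  suffices e : O.ins 0 (O.ins 1 O.mul z) (O.ins 1 O.mul y) = (k : ℤ).negOnePow •
      O.ins 1 (O.ins 2 (O.ins 1 O.mul O.mul) z) y by
    rw [e, Units.smul_def, map_zsmul, AddMonoidHom.smul_apply, ← Units.smul_def,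
      negOnePow_smul_eq_ite]
  by_cases hj : Even j <;> by_cases hk : Even k <;> (
    simp only [Int.even_mul, Int.even_add, Int.even_sub, Int.even_coe_nat, Int.not_even_one, hj, hk,
      iff_true, iff_false, iff_self, not_true, not_false_iff, or_true, or_false, or_self, true_or,
      if_true, if_false, neg_neg, negOnePow_smul_eq_ite] at h₂ ⊢
    first
    | linear_combination (norm := abel1) h₂
    | linear_combination (norm := abel1) -h₂)

theorem cup_assoc {i j k : ℤ} {x y z : G} (hx : x ∈ O.gr i) (hy : y ∈ O.gr j) (hz : z ∈ O.gr k) :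
    O.cup (i + j) k (O.cup i j x y) z = O.cup i (j + k) x (O.cup j k y z) := by
  obtain rfl | ⟨i, rfl, hx'⟩ := eq_zero_or_of_mem_gr hx
  · simp [cup]
  obtain rfl | ⟨j, rfl, hy'⟩ := eq_zero_or_of_mem_gr hy
  · simp [cup]
  obtain rfl | ⟨k, rfl, hz'⟩ := eq_zero_or_of_mem_gr hz
  · simp [cup]
  have h := ins_ins_mul hx' hy' hz'
  simp only [cup, Units.smul_def, map_zsmul, AddMonoidHom.smul_apply, h]
  simp only [← Units.smul_def, smul_smul, ← Int.negOnePow_add]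
  rw [show ((i : ℤ) + j) * k + k - 1 + (i * j + j - 1 + k) =
    i * (j + k) + (j + k) - 1 + (j * k + k - 1) by ring]

theorem one_cup {i : ℤ} {x : G} (hx : x ∈ O.gr i) : O.cup 0 i O.unit x = x := by
  obtain rfl | ⟨i, rfl, hx'⟩ := eq_zero_or_of_mem_gr hx
  · simp [cup]
  have h := O.ins_comm O.mul_mem O.unit_mem hx' (le_refl 0) (by omega)
  rw [O.unit_mul, O.ins_id hx'] at h
  refine Eq.trans ?_ h.symm
  simp only [cup, koszul_smul_eq_ite, negOnePow_smul_eq_ite, Nat.cast_zero]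
  by_cases hi : Even i <;> simp [Int.even_sub, hi]

theorem cup_one {i : ℤ} {x : G} (hx : x ∈ O.gr i) : O.cup i 0 x O.unit = x := by
  obtain rfl | ⟨i, rfl, hx'⟩ := eq_zero_or_of_mem_gr hx
  · simp [cup]
  simp [cup, O.mul_unit, O.ins_id hx']

theorem unit_mem_Z : O.unit ∈ O.Z 0 := by
  refine ⟨mem_gr_of_mem_H O.unit_mem rfl, ?_⟩
  have e₂ : (2 : ℤ).toNat = 2 := rfl
  simp [diff, lieHom_apply, lie, e₂, circ_apply, Finset.sum_range_succ, O.mul_unit, O.unit_mul]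

/-- The homotopy is `x ∘ y`. -/
theorem cup_comm {i j : ℤ} {x y : G} (hx : x ∈ O.Z i) (hy : y ∈ O.Z j) :
    O.cup i j x y - (i * j).negOnePow • O.cup j i y x ∈ O.Bd (i + j) := by
  obtain ⟨hx, hδx⟩ := mem_Z.1 hx
  obtain ⟨hy, hδy⟩ := mem_Z.1 hy
  have hc := diff_mem_Bd (n := i + j) (circ_mem_gr hx hy)
  obtain rfl | ⟨i, rfl, hx'⟩ := eq_zero_or_of_mem_gr hx
  · simp [cup]
  obtain rfl | ⟨j, rfl, hy'⟩ := eq_zero_or_of_mem_gr hy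
  · simp [cup]
  have h := δ_circ hx' hy'
  rw [← diff_natCast, hδx, ← diff_natCast, hδy] at h
  suffices e : O.cup i j x y - ((i : ℤ) * j).negOnePow • O.cup j i y x =
      ((i : ℤ) + 1).negOnePow • O.diff (i + j - 1) (O.circ i x y) by
    rw [e]
    exact zsmul_mem hc _
  rw [diff, lieHom_apply, h]
  simp only [cup_eq_brace, koszul_smul_eq_ite, negOnePow_smul_eq_ite, map_zero,
    AddMonoidHom.zero_apply, smul_zero]
  by_cases hi : Even i <;> by_cases hj : Even j <;> (
    simp only [Int.even_mul, Int.even_add, Int.even_sub, Int.even_coe_nat, Int.not_even_one,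
      even_two, hi, hj, iff_true, iff_false, iff_self, not_true, not_false_iff, or_true, or_false,
      or_self, true_or, if_true, if_false, neg_neg, neg_add, neg_sub, sub_neg_eq_add, neg_zero]
    abel)

/-- The homotopy is `x {y, z}`. -/
theorem leibniz {i j k : ℤ} {x y z : G} (hx : x ∈ O.Z i) (hy : y ∈ O.Z j) (hz : z ∈ O.Z k) :
    O.lie i (j + k) x (O.cup j k y z) - (O.cup (i + j - 1) k (O.lie i j x y) z +
      ((i - 1) * j).negOnePow • O.cup j (i + k - 1) y (O.lie i k x z)) ∈
        O.Bd (i + j + k - 1) := by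
  obtain ⟨hx, hδx⟩ := mem_Z.1 hx
  obtain ⟨hy, hδy⟩ := mem_Z.1 hy
  obtain ⟨hz, hδz⟩ := mem_Z.1 hz
  have hb := diff_mem_Bd (n := i + j + k - 1)
    (by simpa [sub_sub] using brace_mem_gr hx hy hz)
  obtain rfl | ⟨i, rfl, hx'⟩ := eq_zero_or_of_mem_gr hx
  · simp [cup, lie]
  obtain rfl | ⟨j, rfl, hy'⟩ := eq_zero_or_of_mem_gr hy
  · simp [cup, lie]
  obtain rfl | ⟨k, rfl, hz'⟩ := eq_zero_or_of_mem_gr hz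
  · simp [cup, lie]
  rw [leibniz_homotopy hx' hy' hz' hδx hδy hδz, add_sub_cancel_left]
  rw [show (i : ℤ) + j + k - 1 - 1 = i + j + k - 2 by ring] at hb
  exact zsmul_mem hb _

variable (O) in
/-- The cohomology. -/
abbrev Coh (n : ℤ) := O.Z n ⧸ (O.Bd n).addSubgroupOf (O.Z n)

/-- The map on cohomology induced by a biadditive map that preserves cocycles and for which a
coboundary in either argument gives a coboundary. -/
def descend {i j n : ℤ} (f : G →+ G →+ G) (hZ : ∀ x ∈ O.Z i, ∀ y ∈ O.Z j, f x y ∈ O.Z n)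
    (hl : ∀ x ∈ O.Bd i, ∀ y ∈ O.Z j, f x y ∈ O.Bd n)
    (hr : ∀ x ∈ O.Z i, ∀ y ∈ O.Bd j, f x y ∈ O.Bd n) : O.Coh i →+ O.Coh j →+ O.Coh n :=
  QuotientAddGroup.lift _
    (AddMonoidHom.mk' (fun x : O.Z i => QuotientAddGroup.lift _
      (AddMonoidHom.mk' (fun y : O.Z j => (QuotientAddGroup.mk ⟨f x y, hZ x x.2 y y.2⟩ : O.Coh n))
        (fun y y' => by
          rw [← QuotientAddGroup.mk_add]
          congr 1
          exact Subtype.ext (map_add (f x) _ _)))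
      (fun y hy => (QuotientAddGroup.eq_zero_iff _).2 (hr x x.2 y hy)))
      (fun x x' => by
        refine QuotientAddGroup.addMonoidHom_ext _ (AddMonoidHom.ext fun y => ?_)
        change (QuotientAddGroup.mk _ : O.Coh n) = QuotientAddGroup.mk _ + QuotientAddGroup.mk _
        rw [← QuotientAddGroup.mk_add]
        congr 1
        exact Subtype.ext (by simp)))
    (fun x hx => by
      refine QuotientAddGroup.addMonoidHom_ext _ (AddMonoidHom.ext fun y => ?_)
      exact (QuotientAddGroup.eq_zero_iff _).2 (hl x hx y y.2))

theorem coh_eq {n : ℤ} {x y : O.Z n} (h : (x : G) - y ∈ O.Bd n) :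
    (QuotientAddGroup.mk x : O.Coh n) = QuotientAddGroup.mk y := by
  rw [← sub_eq_zero, ← QuotientAddGroup.mk_sub]
  exact (QuotientAddGroup.eq_zero_iff _).2 h

variable (O) in
/-- The cohomology of an operad with multiplication is a Gerstenhaber algebra. -/
def gerstenhaber : GerstenhaberAlgebra O.Coh where
  mul {i j n} h := descend (O.cupHom i j) (fun x hx y hy => h ▸ cup_mem_Z hx hy)
    (fun x hx y hy => h ▸ cup_mem_Bd_left hx hy) (fun x hx y hy => h ▸ cup_mem_Bd_right hx hy)
  one := QuotientAddGroup.mk ⟨O.unit, unit_mem_Z⟩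
  bracket {i j n} h := descend (O.lieHom i j)
    (fun x hx y hy => eq_sub_of_add_eq h.symm ▸ lie_mem_Z hx hy)
    (fun x hx y hy => eq_sub_of_add_eq h.symm ▸ lie_mem_Bd_left hx hy)
    (fun x hx y hy => eq_sub_of_add_eq h.symm ▸ lie_mem_Bd_right hx hy)
  one_mul {i} a := by
    induction a using QuotientAddGroup.induction_on with | H x
    exact congrArg QuotientAddGroup.mk (Subtype.ext (one_cup x.2.1))
  mul_one {i} a := by
    induction a using QuotientAddGroup.induction_on with | H x
    exact congrArg QuotientAddGroup.mk (Subtype.ext (cup_one x.2.1))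
  mul_assoc {i j k ij jk n} hij hjk h h' a b c := by
    subst hij hjk
    induction a using QuotientAddGroup.induction_on with | H x
    induction b using QuotientAddGroup.induction_on with | H y
    induction c using QuotientAddGroup.induction_on with | H z
    exact congrArg QuotientAddGroup.mk (Subtype.ext (cup_assoc x.2.1 y.2.1 z.2.1))
  mul_comm {i j n} h h' a b := by
    subst h
    induction a using QuotientAddGroup.induction_on with | H x
    induction b using QuotientAddGroup.induction_on with | H y
    exact coh_eq (x := ⟨O.cup i j x y, cup_mem_Z x.2 y.2⟩)
      (y := ⟨(i * j).negOnePow • O.cup j i y x,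
        zsmul_mem (add_comm i j ▸ cup_mem_Z y.2 x.2) _⟩)
      (cup_comm x.2 y.2)
  bracket_antisymm {i j n} h h' a b := by
    induction a using QuotientAddGroup.induction_on with | H x
    induction b using QuotientAddGroup.induction_on with | H y
    exact congrArg QuotientAddGroup.mk (Subtype.ext (lie_antisymm i j (x : G) (y : G)))
  jacobi {i j k ij ik jk n} hij hik hjk h₁ h₂ h₃ a b c := by
    obtain rfl : ij = i + j - 1 := by omega
    obtain rfl : ik = i + k - 1 := by omega
    obtain rfl : jk = j + k - 1 := by omega
    induction a using QuotientAddGroup.induction_on with | H x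
    induction b using QuotientAddGroup.induction_on with | H y
    induction c using QuotientAddGroup.induction_on with | H z
    exact congrArg QuotientAddGroup.mk (Subtype.ext (jacobi_int x.2.1 y.2.1 z.2.1))
  leibniz {i j k ij ik jk n} hij hik hjk h₁ h₂ h₃ a b c := by
    obtain rfl : ij = i + j - 1 := by omega
    obtain rfl : ik = i + k - 1 := by omega
    obtain rfl : n = i + j + k - 1 := by omega
    subst hjk
    induction a using QuotientAddGroup.induction_on with | H x
    induction b using QuotientAddGroup.induction_on with | H y
    induction c using QuotientAddGroup.induction_on with | H z
    exact coh_eq (leibniz x.2 y.2 z.2)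

end SignedOperad
end MonoidalHochschild

/-! ### Tensor products of words -/

namespace MonoidalHochschild

section Whisker

variable {M : Type u} [Category.{v} M] [MonoidalCategory M]

theorem whiskerLeft_eq₂ (X : M) {P Q R : M} {f : P ⟶ R} {g : P ⟶ Q} {k : Q ⟶ R} (e : f = g ≫ k) :
    X ◁ f = X ◁ g ≫ X ◁ k := by
  rw [e, whiskerLeft_comp]

theorem whiskerLeft_eq₄ (X : M) {P Q R S T : M} {f : P ⟶ Q} {g : Q ⟶ R} {k : R ⟶ S} {l : S ⟶ T}
    {m : P ⟶ T} (e : f ≫ g ≫ k ≫ l = m) : X ◁ f ≫ X ◁ g ≫ X ◁ k ≫ X ◁ l = X ◁ m := by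
  simp only [← whiskerLeft_comp, e]

theorem whiskerLeft_eq₃₅ (X : M) {P Q R S A B D E : M} {f : P ⟶ Q} {g : Q ⟶ R} {k : R ⟶ S}
    {f' : P ⟶ A} {g' : A ⟶ B} {h' : B ⟶ D} {k' : D ⟶ E} {l' : E ⟶ S}
    (e : f ≫ g ≫ k = f' ≫ g' ≫ h' ≫ k' ≫ l') :
    X ◁ f ≫ X ◁ g ≫ X ◁ k = X ◁ f' ≫ X ◁ g' ≫ X ◁ h' ≫ X ◁ k' ≫ X ◁ l' := by
  simp only [← whiskerLeft_comp, e]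

end Whisker

section Words

universe w
variable {ι : Type w} {M : Type u} [Category.{v} M] [MonoidalCategory M] (r : ι → M)

/-- The right-bracketed tensor product `r x₁ ⊗ (r x₂ ⊗ (⋯ ⊗ 𝟙))` over a word `x₁ x₂ ⋯`. Words are
used in place of families on `Fin n` since appending words is associative and has no arithmetic
of indices. -/
def wordTensor (w : List ι) : M := (tensorPower M w.length).obj (fun q => r (w.get q))

/-- The identity, for two expressions of the same word. -/
def reindex {w w' : List ι} (h : w = w') : wordTensor r w ⟶ wordTensor r w' :=
  eqToHom (congrArg (wordTensor r) h)

@[simp]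
theorem reindex_refl (w : List ι) : reindex r (rfl : w = w) = 𝟙 (wordTensor r w) := rfl

@[simp]
theorem reindex_trans {w w' w'' : List ι} (h : w = w') (h' : w' = w'') :
    reindex r h ≫ reindex r h' = reindex r (h.trans h') := by
  subst h h'
  simp

theorem reindex_cons (x : ι) {w w' : List ι} (h : w = w') (h' : x :: w = x :: w') :
    reindex r h' = r x ◁ reindex r h := by
  subst h
  exact (whiskerLeft_id _ _).symm

/-- The canonical isomorphism from the tensor product over `s ++ t`, the analogue of `splitIso`. -/
def wordSplit : (s t : List ι) → (wordTensor r (s ++ t) ≅ wordTensor r s ⊗ wordTensor r t)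
  | [], t => (λ_ (wordTensor r t)).symm
  | x :: s, t => whiskerLeftIso (r x) (wordSplit s t) ≪≫ (α_ (r x) _ _).symm

variable {r}

/-- The morphism that is `φ` on the subword `s` and the identity on `u` and `t`; the letter `b`
stands for the image of `s`. -/
def wordApply : (u : List ι) → (s t : List ι) → {b : ι} → (wordTensor r s ⟶ r b) →
    (wordTensor r (u ++ (s ++ t)) ⟶ wordTensor r (u ++ b :: t))
  | [], s, t, _, φ => (wordSplit r s t).hom ≫ φ ▷ wordTensor r t
  | x :: u, s, t, _, φ => r x ◁ wordApply u s t φ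

/-- The morphism that is `g` on a single letter and the identity elsewhere. -/
def wordLetter : (u : List ι) → (t : List ι) → {a b : ι} → (r a ⟶ r b) →
    (wordTensor r (u ++ a :: t) ⟶ wordTensor r (u ++ b :: t))
  | [], t, _, _, g => g ▷ wordTensor r t
  | x :: u, t, _, _, g => r x ◁ wordLetter u t g

theorem wordApply_comp_letter (s t : List ι) {a b : ι} (φ : wordTensor r s ⟶ r a)
    (g : r a ⟶ r b) : (u : List ι) →
    wordApply u s t (φ ≫ g) = wordApply u s t φ ≫ wordLetter u t g
  | [] => by
    change (wordSplit r s t).hom ≫ _ = ((wordSplit r s t).hom ≫ _) ≫ g ▷ wordTensor r t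
    rw [comp_whiskerRight, Category.assoc]
  | x :: u => by
    exact whiskerLeft_eq₂ (r x) (wordApply_comp_letter s t φ g u)

variable (r) in
theorem wordSplit_assoc (z t : List ι) : (y : List ι) → (h : (y ++ z) ++ t = y ++ (z ++ t)) →
    reindex r h ≫ (wordSplit r y (z ++ t)).hom ≫ wordTensor r y ◁ (wordSplit r z t).hom ≫
        (α_ _ _ _).inv =
      (wordSplit r (y ++ z) t).hom ≫ (wordSplit r y z).hom ▷ wordTensor r t
  | [], h => by
    change 𝟙 (wordTensor r (z ++ t)) ≫ (λ_ (wordTensor r (z ++ t))).inv ≫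
        (𝟙_ M) ◁ (wordSplit r z t).hom ≫ (α_ (𝟙_ M) _ _).inv =
      (wordSplit r z t).hom ≫ (λ_ (wordTensor r z)).inv ▷ wordTensor r t
    simp
  | x :: y, h => by
    have ih := wordSplit_assoc z t y (by simp)
    rw [reindex_cons r x (List.append_assoc y z t) h]
    change r x ◁ reindex r _ ≫ (r x ◁ (wordSplit r y (z ++ t)).hom ≫ (α_ (r x) _ _).inv) ≫
        (r x ⊗ wordTensor r y) ◁ (wordSplit r z t).hom ≫ (α_ (r x ⊗ wordTensor r y) _ _).inv =
      (r x ◁ (wordSplit r (y ++ z) t).hom ≫ (α_ (r x) _ _).inv) ≫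
        (r x ◁ (wordSplit r y z).hom ≫ (α_ (r x) _ _).inv) ▷ wordTensor r t
    have ih' := congrArg (fun f => r x ◁ f) ih
    simp only [whiskerLeft_comp] at ih'
    rw [comp_whiskerRight, Category.assoc, Category.assoc, ← associator_inv_naturality_middle_assoc,
      ← reassoc_of% ih']
    simp

theorem wordApply_split (y z t : List ι) {a : ι} (ψ : wordTensor r y ⟶ r a) : (x : List ι) →
    (h : (x ++ (y ++ z)) ++ t = x ++ (y ++ (z ++ t))) → (h' : x ++ a :: (z ++ t) = (x ++ a :: z) ++ t) →
    reindex r h ≫ wordApply x y (z ++ t) ψ ≫ reindex r h' ≫ (wordSplit r (x ++ a :: z) t).hom =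
      (wordSplit r (x ++ (y ++ z)) t).hom ≫ wordApply x y z ψ ▷ wordTensor r t
  | [], h, h' => by
    have hs := wordSplit_assoc r z t y (List.append_assoc y z t)
    change reindex r (List.append_assoc y z t) ≫ ((wordSplit r y (z ++ t)).hom ≫ ψ ▷ wordTensor r (z ++ t)) ≫
      𝟙 (r a ⊗ wordTensor r (z ++ t)) ≫ (r a ◁ (wordSplit r z t).hom ≫ (α_ (r a) _ _).inv) =
      (wordSplit r (y ++ z) t).hom ≫ ((wordSplit r y z).hom ≫ ψ ▷ wordTensor r z) ▷ wordTensor r t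
    rw [comp_whiskerRight, ← reassoc_of% hs, Category.id_comp, Category.assoc,
      ← whisker_exchange_assoc, associator_inv_naturality_left]
  | x₀ :: x, h, h' => by
    have ih := wordApply_split y z t ψ x (by simp) (by simp)
    rw [reindex_cons r x₀ (by simp : (x ++ (y ++ z)) ++ t = x ++ (y ++ (z ++ t))) h,
      reindex_cons r x₀ (by simp : x ++ a :: (z ++ t) = (x ++ a :: z) ++ t) h']
    change r x₀ ◁ reindex r _ ≫ r x₀ ◁ wordApply x y (z ++ t) ψ ≫ r x₀ ◁ reindex r _ ≫
        (r x₀ ◁ (wordSplit r (x ++ a :: z) t).hom ≫ (α_ (r x₀) _ _).inv) =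
      (r x₀ ◁ (wordSplit r (x ++ (y ++ z)) t).hom ≫ (α_ (r x₀) _ _).inv) ≫
        (r x₀ ◁ wordApply x y z ψ) ▷ wordTensor r t
    have ih' := congrArg (fun f => r x₀ ◁ f) ih
    simp only [whiskerLeft_comp] at ih'
    rw [reassoc_of% ih']
    simp

/-- Applying `ψ` inside the subword and then `φ` to the result is one application to the whole
subword. -/
theorem wordApply_wordApply (x y z t : List ι) {a b : ι} (ψ : wordTensor r y ⟶ r a)
    (φ : wordTensor r (x ++ a :: z) ⟶ r b) : (u : List ι) →
    (h : u ++ ((x ++ (y ++ z)) ++ t) = (u ++ x) ++ (y ++ (z ++ t))) →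
    (h' : (u ++ x) ++ a :: (z ++ t) = u ++ ((x ++ a :: z) ++ t)) →
    reindex r h ≫ wordApply (u ++ x) y (z ++ t) ψ ≫ reindex r h' ≫
        wordApply u (x ++ a :: z) t φ =
      wordApply u (x ++ (y ++ z)) t (wordApply x y z ψ ≫ φ)
  | [], h, h' => by
    have hs := wordApply_split y z t ψ x h h'
    change reindex r _ ≫ wordApply x y (z ++ t) ψ ≫ reindex r _ ≫
      (wordSplit r (x ++ a :: z) t).hom ≫ φ ▷ wordTensor r t =
      (wordSplit r (x ++ (y ++ z)) t).hom ≫ (wordApply x y z ψ ≫ φ) ▷ wordTensor r t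
    rw [reassoc_of% hs, comp_whiskerRight]
  | x₀ :: u, h, h' => by
    have ih := wordApply_wordApply x y z t ψ φ u (by simp) (by simp)
    rw [reindex_cons r x₀ (by simp : u ++ ((x ++ (y ++ z)) ++ t) = (u ++ x) ++ (y ++ (z ++ t))) h,
      reindex_cons r x₀ (by simp : (u ++ x) ++ a :: (z ++ t) = u ++ ((x ++ a :: z) ++ t)) h']
    exact whiskerLeft_eq₄ (r x₀) ih

theorem wordApply_append_split (s v t : List ι) {b : ι} (ψ : wordTensor r v ⟶ r b) :
    (y : List ι) → (h : y ++ (s ++ (v ++ t)) = (y ++ s) ++ (v ++ t)) →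
    (h' : (y ++ s) ++ b :: t = y ++ (s ++ b :: t)) →
    reindex r h ≫ wordApply (y ++ s) v t ψ ≫ reindex r h' ≫ (wordSplit r y (s ++ b :: t)).hom =
      (wordSplit r y (s ++ (v ++ t))).hom ≫ wordTensor r y ◁ wordApply s v t ψ
  | [], h, h' => by
    change 𝟙 (wordTensor r (s ++ (v ++ t))) ≫ wordApply s v t ψ ≫
      𝟙 (wordTensor r (s ++ b :: t)) ≫ (λ_ (wordTensor r (s ++ b :: t))).inv =
      (λ_ (wordTensor r (s ++ (v ++ t)))).inv ≫ (𝟙_ M) ◁ wordApply s v t ψ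
    simp
  | x₀ :: y, h, h' => by
    have ih := wordApply_append_split s v t ψ y (by simp) (by simp)
    rw [reindex_cons r x₀ (by simp : y ++ (s ++ (v ++ t)) = (y ++ s) ++ (v ++ t)) h,
      reindex_cons r x₀ (by simp : (y ++ s) ++ b :: t = y ++ (s ++ b :: t)) h']
    change r x₀ ◁ reindex r _ ≫ r x₀ ◁ wordApply (y ++ s) v t ψ ≫ r x₀ ◁ reindex r _ ≫
        (r x₀ ◁ (wordSplit r y (s ++ b :: t)).hom ≫ (α_ (r x₀) _ _).inv) =
      (r x₀ ◁ (wordSplit r y (s ++ (v ++ t))).hom ≫ (α_ (r x₀) _ _).inv) ≫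
        (r x₀ ⊗ wordTensor r y) ◁ wordApply s v t ψ
    have ih' := congrArg (fun f => r x₀ ◁ f) ih
    simp only [whiskerLeft_comp] at ih'
    rw [reassoc_of% ih']
    simp

/-- Applications to disjoint subwords commute. -/
theorem wordApply_comm (y s v t : List ι) {a b : ι} (φ : wordTensor r y ⟶ r a)
    (ψ : wordTensor r v ⟶ r b) : (u : List ι) →
    (h₁ : u ++ a :: (s ++ (v ++ t)) = (u ++ a :: s) ++ (v ++ t)) →
    (h₂ : u ++ (y ++ (s ++ (v ++ t))) = (u ++ (y ++ s)) ++ (v ++ t)) →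
    (h₃ : (u ++ (y ++ s)) ++ b :: t = u ++ (y ++ (s ++ b :: t))) →
    (h₄ : u ++ a :: (s ++ b :: t) = (u ++ a :: s) ++ b :: t) →
    wordApply u y (s ++ (v ++ t)) φ ≫ reindex r h₁ ≫ wordApply (u ++ a :: s) v t ψ =
      reindex r h₂ ≫ wordApply (u ++ (y ++ s)) v t ψ ≫ reindex r h₃ ≫
        wordApply u y (s ++ b :: t) φ ≫ reindex r h₄
  | [], h₁, h₂, h₃, h₄ => by
    have hs := wordApply_append_split s v t ψ y h₂ h₃
    change ((wordSplit r y (s ++ (v ++ t))).hom ≫ φ ▷ wordTensor r (s ++ (v ++ t))) ≫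
        𝟙 (r a ⊗ wordTensor r (s ++ (v ++ t))) ≫ r a ◁ wordApply s v t ψ =
      reindex r h₂ ≫ wordApply (y ++ s) v t ψ ≫ reindex r h₃ ≫
        ((wordSplit r y (s ++ b :: t)).hom ≫ φ ▷ wordTensor r (s ++ b :: t)) ≫
          𝟙 (r a ⊗ wordTensor r (s ++ b :: t))
    rw [Category.comp_id, reassoc_of% hs, Category.id_comp, Category.assoc, whisker_exchange]
  | x₀ :: u, h₁, h₂, h₃, h₄ => by
    have ih := wordApply_comm y s v t φ ψ u (by simp) (by simp) (by simp) (by simp)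
    rw [reindex_cons r x₀ (List.cons.inj h₁).2 h₁, reindex_cons r x₀ (List.cons.inj h₂).2 h₂,
      reindex_cons r x₀ (List.cons.inj h₃).2 h₃, reindex_cons r x₀ (List.cons.inj h₄).2 h₄]
    exact whiskerLeft_eq₃₅ (r x₀) ih

end Words
end MonoidalHochschild

/-! ### Cochains evaluated on words -/

namespace MonoidalHochschild

section HEq

variable {M : Type u} [Category.{v} M]

theorem comp_heq_comp {P P' Q Q' R R' : M} (hP : P = P') (hQ : Q = Q') (hR : R = R')
    {f : P ⟶ Q} {f' : P' ⟶ Q'} {g : Q ⟶ R} {g' : Q' ⟶ R'} (hf : f ≍ f') (hg : g ≍ g') :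
    (f ≫ g) ≍ (f' ≫ g') := by
  subst hP hQ hR hf hg
  rfl

theorem inv_heq_inv {P P' Q Q' : M} (hP : P = P') (hQ : Q = Q')
    {f : P ≅ Q} {f' : P' ≅ Q'} (hf : f ≍ f') : f.inv ≍ f'.inv := by
  subst hP hQ hf
  rfl

theorem map_heq_map {N : Type u'} [Category.{v'} N] (F : M ⥤ N) {P P' Q Q' : M} (hP : P = P')
    (hQ : Q = Q') {f : P ⟶ Q} {f' : P' ⟶ Q'} (hf : f ≍ f') : F.map f ≍ F.map f' := by
  subst hP hQ hf
  rfl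

variable [MonoidalCategory M]

theorem whiskerLeft_heq (X : M) {P P' Q Q' : M} (hP : P = P') (hQ : Q = Q')
    {f : P ⟶ Q} {f' : P' ⟶ Q'} (hf : f ≍ f') : (X ◁ f) ≍ (X ◁ f') := by
  subst hP hQ hf
  rfl

theorem whiskerLeftIso_heq (X : M) {P P' Q Q' : M} (hP : P = P') (hQ : Q = Q')
    {f : P ≅ Q} {f' : P' ≅ Q'} (hf : f ≍ f') : whiskerLeftIso X f ≍ whiskerLeftIso X f' := by
  subst hP hQ hf
  rfl

theorem split_heq (X : M) {P P' A A' B B' : M} (hP : P = P') (hA : A = A') (hB : B = B')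
    {f : P ≅ A ⊗ B} {f' : P' ≅ A' ⊗ B'} (hf : f ≍ f') :
    (whiskerLeftIso X f ≪≫ (α_ X A B).symm) ≍ (whiskerLeftIso X f' ≪≫ (α_ X A' B').symm) := by
  subst hP hA hB hf
  rfl

theorem split_whiskerRight_heq {P P' A A' B B' E E' : M} (hP : P = P') (hA : A = A') (hB : B = B') (hE : E = E')
    {f : P ≅ A ⊗ B} {f' : P' ≅ A' ⊗ B'} (hf : f ≍ f') {e : A ⟶ E} {e' : A' ⟶ E'} (he : e ≍ e') :
    (f.hom ≫ e ▷ B) ≍ (f'.hom ≫ e' ▷ B') := by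
  subst hP hA hB hE hf he
  rfl

end HEq

section Letters

/-- The letters of a word of length `n` as a family on `Fin n`. -/
def letters {ι : Type*} {n : ℕ} (w : List ι) (h : w.length = n) : Fin n → ι :=
  fun q => w.get (q.cast h.symm)

variable {M : Type u} [Category.{v} M] {ι : Type*} (r : ι → M)

theorem firstArgs_letters {b j : ℕ} (s t : List ι) (h : (s ++ t).length = b + j)
    (hs : s.length = j) :
    (firstArgs M b j).obj (fun q => r (letters (s ++ t) h q)) = fun q => r (letters s hs q) := by
  funext q
  simp [letters, List.getElem_append_left, hs]

theorem lastArgs_letters {b j : ℕ} (s t : List ι) (h : (s ++ t).length = b + j)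
    (hs : s.length = j) (ht : t.length = b) :
    (lastArgs M b j).obj (fun q => r (letters (s ++ t) h q)) = fun q => r (letters t ht q) := by
  funext q
  simp [letters, List.getElem_append_right, hs]

theorem exists_letters {n : ℕ} (X : Fin n → ι) :
    ∃ (w : List ι) (h : w.length = n), X = letters w h :=
  ⟨List.ofFn X, List.length_ofFn, by funext q; simp [letters]⟩

variable [MonoidalCategory M]

theorem tensorPower_letters {n : ℕ} (w : List ι) (h : w.length = n) :
    (tensorPower M n).obj (fun q => r (letters w h q)) = wordTensor r w := by
  subst h
  rfl

theorem splitIso_heq_wordSplit (t : List ι) : (s : List ι) →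
    (h : (s ++ t).length = t.length + s.length) →
    splitIso t.length s.length (fun q => r (letters (s ++ t) h q)) ≍ wordSplit r s t
  | [], _ => HEq.rfl
  | x :: s, h => by
    have h' : (s ++ t).length = t.length + s.length := Nat.succ.inj h
    exact split_heq (r x) (tensorPower_letters r (s ++ t) h')
      (congrArg (tensorPower M _).obj (firstArgs_letters r s t h' rfl))
      (congrArg (tensorPower M _).obj (lastArgs_letters r s t h' rfl rfl))
      (splitIso_heq_wordSplit t s h')

end Letters

section LettersHom

variable {C : Type u} [Category.{v} C] {D : Type u'} [Category.{v'} D]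

/-- The morphism of families given by `g` at one letter and by identities elsewhere. -/
def lettersHom (t : List C) {a b : C} (g : a ⟶ b) : (u : List C) →
    (h : (u ++ a :: t).length = t.length + 1 + u.length) →
    (h' : (u ++ b :: t).length = t.length + 1 + u.length) →
    (letters (u ++ a :: t) h ⟶ letters (u ++ b :: t) h')
  | [], h, h' => fun q => Fin.cases (motive := fun q =>
      letters ([] ++ a :: t) h q ⟶ letters ([] ++ b :: t) h' q) g (fun q => 𝟙 (t.get q)) q
  | x :: u, h, h' => fun q => Fin.cases (motive := fun q =>
      letters (x :: u ++ a :: t) h q ⟶ letters (x :: u ++ b :: t) h' q) (𝟙 x)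
      (fun q => lettersHom t g u (Nat.succ.inj h) (Nat.succ.inj h') q) q

variable [MonoidalCategory D]

theorem tensorHom_heq_whiskerLeft {X P P' Q Q' : D} (hP : P = P') (hQ : Q = Q') {i : X ⟶ X}
    (hi : i = 𝟙 X) {f : P ⟶ Q} {f' : P' ⟶ Q'} (hf : f ≍ f') : (i ⊗ₘ f) ≍ (X ◁ f') := by
  subst hP hQ hf hi
  rw [id_tensorHom]

theorem map_lettersHom_heq (F : C ⥤ D) (t : List C) {a b : C} (g : a ⟶ b) : (u : List C) →
    (h : (u ++ a :: t).length = t.length + 1 + u.length) →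
    (h' : (u ++ b :: t).length = t.length + 1 + u.length) →
    (tensorPower D _).map ((mapArgs F _).map (lettersHom t g u h h')) ≍
      wordLetter (r := F.obj) u t (F.map g)
  | [], h, h' => by
    have e : F.map g ⊗ₘ (tensorPower D t.length).map ((mapArgs F t.length).map (𝟙 t.get)) =
        F.map g ▷ wordTensor F.obj t := by
      rw [CategoryTheory.Functor.map_id, CategoryTheory.Functor.map_id, tensorHom_id]
      rfl
    exact heq_of_eq e
  | x :: u, h, h' =>
    tensorHom_heq_whiskerLeft (tensorPower_letters F.obj _ (Nat.succ.inj h))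
      (tensorPower_letters F.obj _ (Nat.succ.inj h')) (F.map_id x)
      (map_lettersHom_heq F t g u (Nat.succ.inj h) (Nat.succ.inj h'))

end LettersHom

section Cochains

variable {C : Type u} [Category.{v} C] [MonoidalCategory C]

variable (C) in
/-- The right-bracketed tensor product of a word of objects. -/
abbrev wordProd (w : List C) : C := wordTensor (fun x : C => x) w

/-- The canonical isomorphism that brackets the subword `s`, the analogue of `groupIso`. -/
def wordGroup : (u s t : List C) →
    (wordProd C (u ++ (s ++ t)) ≅ wordProd C (u ++ wordProd C s :: t))
  | [], s, t => wordSplit (fun x : C => x) s t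
  | x :: u, s, t => whiskerLeftIso x (wordGroup u s t)

theorem wordGroup_hom (s t : List C) : (u : List C) →
    (wordGroup u s t).hom = wordApply (r := fun x : C => x) u s t (b := wordProd C s) (𝟙 _)
  | [] => (Category.comp_id _).symm.trans
      (congrArg (fun f => (wordSplit (fun x : C => x) s t).hom ≫ f) (id_whiskerRight _ _).symm)
  | x :: u => congrArg (fun f => x ◁ f) (wordGroup_hom s t u)

theorem groupArgs_letters (s t : List C) : (u : List C) →
    (h : (u ++ (s ++ t)).length = t.length + s.length + u.length) →
    (h' : (u ++ wordProd C s :: t).length = t.length + 1 + u.length) →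
    (groupArgs C t.length s.length u.length).obj (letters (u ++ (s ++ t)) h) =
      letters (u ++ wordProd C s :: t) h'
  | [], h, h' => by
    funext q
    refine Fin.cases ?_ (fun q => ?_) q
    · exact congrArg (tensorPower C s.length).obj (firstArgs_letters (b := t.length) (j := s.length) (fun x : C => x) s t h rfl)
    · exact congrFun
        (lastArgs_letters (b := t.length) (j := s.length) (fun x : C => x) s t h rfl rfl) q
  | x :: u, h, h' => by
    funext q
    refine Fin.cases rfl (fun q => ?_) q
    exact congrFun (groupArgs_letters s t u (Nat.succ.inj h) (Nat.succ.inj h')) q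

theorem groupIso_heq_wordGroup (s t : List C) : (u : List C) →
    (h : (u ++ (s ++ t)).length = t.length + s.length + u.length) →
    groupIso t.length s.length u.length (letters (u ++ (s ++ t)) h) ≍ wordGroup u s t
  | [], h => splitIso_heq_wordSplit (fun x : C => x) t s h
  | x :: u, h => by
    have h' : (u ++ (s ++ t)).length = t.length + s.length + u.length := Nat.succ.inj h
    have h'' : (u ++ wordProd C s :: t).length = t.length + 1 + u.length := by
      simp [Nat.add_comm]
    exact whiskerLeftIso_heq x (tensorPower_letters (fun x : C => x) _ h')
      ((congrArg (tensorPower C _).obj (groupArgs_letters s t u h' h'')).trans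
        (tensorPower_letters (fun x : C => x) _ h'')) (groupIso_heq_wordGroup s t u h')

variable {D : Type u'} [Category.{v'} D] [MonoidalCategory D] {F : C ⥤ D}

/-- The component of a cochain at a word of objects. -/
def Cochain.eval {n : ℕ} (c : Cochain F n) (w : List C) (h : w.length = n) :
    wordTensor F.obj w ⟶ F.obj (wordProd C w) :=
  (c.cast h.symm).app w.get

theorem Cochain.cast_rfl {n : ℕ} (c : Cochain F n) : c.cast rfl = c := rfl

theorem Cochain.eval_heq {n : ℕ} (c : Cochain F n) (w : List C) (h : w.length = n) :
    c.app (letters w h) ≍ c.eval w h := by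
  subst h
  rfl

theorem Cochain.eval_cast {m n : ℕ} (e : m = n) (c : Cochain F m) (w : List C)
    (h : w.length = n) : (c.cast e).eval w h = c.eval w (h.trans e.symm) := by
  subst e
  rfl

theorem Cochain.ext_eval {n : ℕ} {c c' : Cochain F n}
    (H : ∀ (w : List C) (h : w.length = n), c.eval w h = c'.eval w h) : c = c' := by
  ext X
  obtain ⟨w, h, rfl⟩ := exists_letters X
  exact eq_of_heq ((c.eval_heq w h).trans ((heq_of_eq (H w h)).trans (c'.eval_heq w h).symm))

theorem Cochain.app_heq {n : ℕ} (c : Cochain F n) {X Y : Fin n → C} (h : X = Y) :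
    c.app X ≍ c.app Y := by
  subst h
  rfl

theorem applyAt_heq_wordApply (s t : List C) (e : Cochain F s.length) : (u : List C) →
    (h : (u ++ (s ++ t)).length = t.length + s.length + u.length) →
    applyAt t.length e u.length (letters (u ++ (s ++ t)) h) ≍
      wordApply (r := F.obj) u s t (b := wordProd C s) (e.eval s rfl)
  | [], h => by
    have h₁ := firstArgs_letters (b := t.length) (j := s.length) (fun x : C => x) s t h rfl
    refine split_whiskerRight_heq (tensorPower_letters F.obj (s ++ t) h)
      (congrArg (tensorPower D _).obj
        (firstArgs_letters (b := t.length) (j := s.length) F.obj s t h rfl))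
      (congrArg (tensorPower D _).obj
        (lastArgs_letters (b := t.length) (j := s.length) F.obj s t h rfl rfl))
      (congrArg (fun Y => F.obj ((tensorPower C _).obj Y)) h₁)
      (splitIso_heq_wordSplit F.obj t s h) ?_
    exact e.app_heq h₁
  | x :: u, h => by
    have h' : (u ++ (s ++ t)).length = t.length + s.length + u.length := Nat.succ.inj h
    have h'' : (u ++ wordProd C s :: t).length = t.length + 1 + u.length := by
      simp [Nat.add_comm]
    exact whiskerLeft_heq (F.obj x) (tensorPower_letters F.obj _ h')
      ((congrArg (fun Y => (tensorPower D _).obj ((mapArgs F _).obj Y))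
        (groupArgs_letters s t u h' h'')).trans (tensorPower_letters F.obj _ h''))
      (applyAt_heq_wordApply s t e u h')

theorem Cochain.eval_insert (u s t : List C) (c : Cochain F (t.length + 1 + u.length))
    (e : Cochain F s.length)
    (h : (u ++ (s ++ t)).length = t.length + s.length + u.length)
    (h' : (u ++ wordProd C s :: t).length = t.length + 1 + u.length) :
    (insert t.length s.length u.length c e).eval (u ++ (s ++ t)) h =
      wordApply (r := F.obj) u s t (b := wordProd C s) (e.eval s rfl) ≫
        c.eval (u ++ wordProd C s :: t) h' ≫ F.map (wordGroup u s t).inv := by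
  refine eq_of_heq ((Cochain.eval_heq _ _ h).symm.trans ?_)
  have hg := groupArgs_letters s t u h h'
  have hw := tensorPower_letters (fun x : C => x) _ h
  have hw' := (congrArg (tensorPower C _).obj hg).trans
    (tensorPower_letters (fun x : C => x) _ h')
  refine comp_heq_comp (tensorPower_letters F.obj _ h)
    ((congrArg (fun Y => (tensorPower D _).obj ((mapArgs F _).obj Y)) hg).trans
      (tensorPower_letters F.obj _ h')) (congrArg F.obj hw)
    (applyAt_heq_wordApply s t e u h) (comp_heq_comp
      ((congrArg (fun Y => (tensorPower D _).obj ((mapArgs F _).obj Y)) hg).trans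
      (tensorPower_letters F.obj _ h')) (congrArg F.obj hw') (congrArg F.obj hw)
      ((c.app_heq hg).trans (c.eval_heq _ h'))
      (map_heq_map F hw' hw (inv_heq_inv hw hw' (groupIso_heq_wordGroup s t u h))))

/-- The insertion of `e` into the slot number `p + 1` of `c`, with the degree of the result a
variable. -/
def Cochain.comp {i j n : ℕ} (p : ℕ) (c : Cochain F i) (e : Cochain F j) (hp : p < i)
    (h : i + j = n + 1) : Cochain F n :=
  (insert (i - 1 - p) j p (c.cast (by omega)) e).cast (by omega)

/-- The description of the insertion on words, from which the operad axioms follow. -/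
theorem Cochain.eval_comp {i j n p : ℕ} (c : Cochain F i) (e : Cochain F j) (hp : p < i)
    (h : i + j = n + 1) (u s t : List C) (hu : u.length = p) (hs : s.length = j)
    (hw : (u ++ (s ++ t)).length = n) (hw' : (u ++ wordProd C s :: t).length = i) :
    (c.comp p e hp h).eval (u ++ (s ++ t)) hw =
      wordApply (r := F.obj) u s t (b := wordProd C s) (e.eval s hs) ≫
        c.eval (u ++ wordProd C s :: t) hw' ≫ F.map (wordGroup u s t).inv := by
  subst hu hs
  obtain rfl : i = t.length + 1 + u.length := by
    rw [← hw']
    simp [Nat.add_comm]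
  have ht : t.length + 1 + u.length - 1 - u.length = t.length := by omega
  rw [Cochain.comp, Cochain.eval_cast]
  have key : ∀ (b : ℕ) (hb : b = t.length) (hc : t.length + 1 + u.length = b + 1 + u.length)
      (hw : (u ++ (s ++ t)).length = b + s.length + u.length),
      (insert b s.length u.length (c.cast hc) e).eval (u ++ (s ++ t)) hw =
      wordApply (r := F.obj) u s t (b := wordProd C s) (e.eval s rfl) ≫
        c.eval (u ++ wordProd C s :: t) hw' ≫ F.map (wordGroup u s t).inv := by
    rintro b rfl hc hw
    exact Cochain.eval_insert u s t c e hw hw'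
  exact key _ ht _ _

/-- Naturality of a cochain in one variable. -/
theorem Cochain.eval_letter {n : ℕ} (c : Cochain F n) (u t : List C) {a b : C} (g : a ⟶ b)
    (h : (u ++ a :: t).length = n) (h' : (u ++ b :: t).length = n) :
    wordLetter (r := F.obj) u t (F.map g) ≫ c.eval (u ++ b :: t) h' =
      c.eval (u ++ a :: t) h ≫ F.map (wordLetter (r := fun x : C => x) u t g) := by
  obtain rfl : n = t.length + 1 + u.length := by
    rw [← h]
    simp [Nat.add_comm]
  have e {w : List C} (h : w.length = t.length + 1 + u.length) := tensorPower_letters F.obj w h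
  have e' {w : List C} (h : w.length = t.length + 1 + u.length) :=
    tensorPower_letters (fun x : C => x) w h
  refine eq_of_heq (((comp_heq_comp (e h) (e h') (congrArg F.obj (e' h'))
    (map_lettersHom_heq F t g u h h') (c.eval_heq _ h')).symm.trans
    (heq_of_eq (c.naturality (lettersHom t g u h h')))).trans
    (comp_heq_comp (e h) (congrArg F.obj (e' h)) (congrArg F.obj (e' h')) (c.eval_heq _ h)
      (map_heq_map F (e' h) (e' h') (map_lettersHom_heq (𝟭 C) t g u h h'))))

end Cochains

end MonoidalHochschild

/-! ### The operad axioms for insertion of cochains -/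

namespace MonoidalHochschild

/-- A word is a concatenation of words of prescribed lengths. -/
theorem exists_append₃ {ι : Type*} {w : List ι} {p j b : ℕ} (h : w.length = p + (j + b)) :
    ∃ u s t : List ι, w = u ++ (s ++ t) ∧ u.length = p ∧ s.length = j ∧ t.length = b := by
  refine ⟨w.take p, (w.drop p).take j, (w.drop p).drop j, by simp, ?_, ?_, ?_⟩ <;> simp <;> omega

section WordLemmas

universe w
variable {ι : Type w} {M : Type u} [Category.{v} M] [MonoidalCategory M] {r : ι → M}

theorem wordLetter_comp (t : List ι) {a b c : ι} (f : r a ⟶ r b) (g : r b ⟶ r c) :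
    (u : List ι) → wordLetter u t f ≫ wordLetter u t g = wordLetter u t (f ≫ g)
  | [] => (comp_whiskerRight _ _ _).symm
  | x :: u => (whiskerLeft_eq₂ (r x) (wordLetter_comp t f g u).symm).symm

theorem wordLetter_id (t : List ι) (a : ι) : (u : List ι) → wordLetter u t (𝟙 (r a)) = 𝟙 _
  | [] => id_whiskerRight _ _
  | x :: u => (congrArg (fun f => r x ◁ f) (wordLetter_id t a u)).trans (whiskerLeft_id _ _)

theorem wordApply_singleton (t : List ι) (x : ι) : (u : List ι) →
    wordApply u [x] t (b := x) (ρ_ (r x)).hom = 𝟙 (wordTensor r (u ++ x :: t))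
  | [] => by
    have h (X Y : M) : (X ◁ (λ_ Y).inv ≫ (α_ X (𝟙_ M) Y).inv) ≫ (ρ_ X).hom ▷ Y = 𝟙 _ := by simp
    exact h _ _
  | y :: u => (congrArg (fun f => r y ◁ f) (wordApply_singleton t x u)).trans (whiskerLeft_id _ _)

end WordLemmas

section Inverse

variable {M : Type u} [Category.{v} M]

theorem inv_eq_inv₄₂ {P Q R S T U : M} {f : P ≅ Q} {g : Q ≅ R} {h : R ≅ S} {k : S ≅ T}
    {f' : P ≅ U} {g' : U ≅ T} (e : f.hom ≫ g.hom ≫ h.hom ≫ k.hom = f'.hom ≫ g'.hom) :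
    k.inv ≫ h.inv ≫ g.inv ≫ f.inv = g'.inv ≫ f'.inv := by
  have := congrArg Iso.inv (Iso.ext e : f ≪≫ g ≪≫ h ≪≫ k = f' ≪≫ g')
  simpa using this

theorem inv_eq_inv₃₅ {P Q R S A B X Y : M} {f : P ≅ Q} {g : Q ≅ R} {h : R ≅ S}
    {f' : P ≅ A} {g' : A ≅ B} {h' : B ≅ X} {k' : X ≅ Y} {l' : Y ≅ S}
    (e : f.hom ≫ g.hom ≫ h.hom = f'.hom ≫ g'.hom ≫ h'.hom ≫ k'.hom ≫ l'.hom) :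
    h.inv ≫ g.inv ≫ f.inv = l'.inv ≫ k'.inv ≫ h'.inv ≫ g'.inv ≫ f'.inv := by
  have := congrArg Iso.inv (Iso.ext e : f ≪≫ g ≪≫ h = f' ≪≫ g' ≪≫ h' ≪≫ k' ≪≫ l')
  simpa using this

end Inverse

section Unit

universe w
variable {ι : Type w} {M : Type u} [Category.{v} M] [MonoidalCategory M] (r : ι → M)

/-- `reindex` as an isomorphism. -/
def reindexIso {w w' : List ι} (h : w = w') : wordTensor r w ≅ wordTensor r w' where
  hom := reindex r h
  inv := reindex r h.symm

theorem wordSplit_nil : (s : List ι) → (h : s ++ [] = s) →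
    (wordSplit r s []).hom ≫ (ρ_ (wordTensor r s)).hom = reindex r h
  | [], h => by
    have h : (λ_ (𝟙_ M)).inv ≫ (ρ_ (𝟙_ M)).hom = 𝟙 _ := by rw [← unitors_equal, Iso.inv_hom_id]
    exact h
  | x :: s, h => by
    have h' := wordSplit_nil s (List.append_nil s)
    rw [reindex_cons r x (List.append_nil s) h, ← h']
    have e (X Y Z : M) (f : Y ⟶ Z ⊗ 𝟙_ M) : (X ◁ f ≫ (α_ X Z (𝟙_ M)).inv) ≫ (ρ_ (X ⊗ Z)).hom =
      X ◁ (f ≫ (ρ_ Z).hom) := by simp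
    exact e _ _ _ _

end Unit

variable {C : Type u} [Category.{v} C] [MonoidalCategory C]
  {D : Type u'} [Category.{v'} D] [MonoidalCategory D] {F : C ⥤ D}

theorem Cochain.eval_reindex {n : ℕ} (c : Cochain F n) {w w' : List C} (e : w = w')
    (h : w.length = n) :
    c.eval w h = reindex F.obj e ≫ c.eval w' (e ▸ h) ≫ F.map (reindex (fun x : C => x) e.symm) := by
  subst e
  simp

/-- Bracketing a subword in two steps. The statement is `wordApply_wordApply` for identities. -/
theorem wordGroup_wordGroup (u x y z t : List C)
    (h : u ++ ((x ++ (y ++ z)) ++ t) = (u ++ x) ++ (y ++ (z ++ t)))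
    (h' : (u ++ x) ++ wordProd C y :: (z ++ t) = u ++ ((x ++ wordProd C y :: z) ++ t)) :
    (wordGroup u (x ++ wordProd C y :: z) t).inv ≫ reindex (fun x : C => x) h'.symm ≫
        (wordGroup (u ++ x) y (z ++ t)).inv ≫ reindex (fun x : C => x) h.symm =
      wordLetter (r := fun x : C => x) u t (a := wordProd C (x ++ wordProd C y :: z))
        (b := wordProd C (x ++ (y ++ z))) (wordGroup x y z).inv ≫
          (wordGroup u (x ++ (y ++ z)) t).inv := by
  have h₁ := wordApply_wordApply (r := fun x : C => x) x y z t (a := wordProd C y)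
    (b := wordProd C (x ++ wordProd C y :: z)) (𝟙 _) (𝟙 _) u h h'
  have h₂ := wordApply_comp_letter (r := fun x : C => x) (x ++ (y ++ z)) t
    (a := wordProd C (x ++ (y ++ z))) (b := wordProd C (x ++ wordProd C y :: z)) (𝟙 _)
    (wordGroup x y z).hom u
  have h₃ := wordLetter_comp (r := fun x : C => x) t
    (a := wordProd C (x ++ (y ++ z))) (b := wordProd C (x ++ wordProd C y :: z))
    (c := wordProd C (x ++ (y ++ z))) (wordGroup x y z).hom (wordGroup x y z).inv u
  have h₄ := wordLetter_comp (r := fun x : C => x) t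
    (a := wordProd C (x ++ wordProd C y :: z)) (b := wordProd C (x ++ (y ++ z)))
    (c := wordProd C (x ++ wordProd C y :: z)) (wordGroup x y z).inv (wordGroup x y z).hom u
  rw [Iso.hom_inv_id, wordLetter_id] at h₃
  rw [Iso.inv_hom_id, wordLetter_id] at h₄
  rw [Category.comp_id, ← wordGroup_hom, ← wordGroup_hom, ← wordGroup_hom] at h₁
  rw [Category.id_comp, ← wordGroup_hom, ← h₁] at h₂
  exact inv_eq_inv₄₂ (f := reindexIso _ h) (h := reindexIso _ h') (g' := ⟨_, _, h₃, h₄⟩) h₂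

/-- Bracketing disjoint subwords in either order. The statement is `wordApply_comm` for
identities. -/
theorem wordGroup_comm (u y s v t : List C)
    (h₁ : u ++ wordProd C y :: (s ++ (v ++ t)) = (u ++ wordProd C y :: s) ++ (v ++ t))
    (h₂ : u ++ (y ++ (s ++ (v ++ t))) = (u ++ (y ++ s)) ++ (v ++ t))
    (h₃ : (u ++ (y ++ s)) ++ wordProd C v :: t = u ++ (y ++ (s ++ wordProd C v :: t)))
    (h₄ : u ++ wordProd C y :: (s ++ wordProd C v :: t) =
      (u ++ wordProd C y :: s) ++ wordProd C v :: t) :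
    (wordGroup (u ++ wordProd C y :: s) v t).inv ≫ reindex (fun x : C => x) h₁.symm ≫
        (wordGroup u y (s ++ (v ++ t))).inv =
      reindex (fun x : C => x) h₄.symm ≫ (wordGroup u y (s ++ wordProd C v :: t)).inv ≫
        reindex (fun x : C => x) h₃.symm ≫ (wordGroup (u ++ (y ++ s)) v t).inv ≫
          reindex (fun x : C => x) h₂.symm := by
  have h := wordApply_comm (r := fun x : C => x) y s v t (a := wordProd C y) (b := wordProd C v)
    (𝟙 _) (𝟙 _) u h₁ h₂ h₃ h₄
  rw [← wordGroup_hom, ← wordGroup_hom, ← wordGroup_hom, ← wordGroup_hom] at h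
  exact inv_eq_inv₃₅ (g := reindexIso _ h₁) (f' := reindexIso _ h₂) (h' := reindexIso _ h₃)
    (l' := reindexIso _ h₄) h

/-- Insertion is associative when the second insertion is into the part that was inserted. -/
theorem Cochain.comp_assoc {i j k ij jk n p q : ℕ} (c : Cochain F i) (e : Cochain F j)
    (f : Cochain F k) (hp : p < i) (hq : q < j) (hij : i + j = ij + 1) (hjk : j + k = jk + 1)
    (h : ij + k = n + 1) (h' : i + jk = n + 1) (hpq : p + q < ij) :
    (c.comp p e hp hij).comp (p + q) f hpq h = c.comp p (e.comp q f hq hjk) hp h' := by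
  refine Cochain.ext_eval fun w hw => ?_
  obtain ⟨u, s, t, rfl, hu, hs, ht⟩ := exists_append₃ (p := p) (j := jk) (b := i - 1 - p)
    (hw.trans (by omega))
  obtain ⟨x, y, z, rfl, hx, hy, hz⟩ := exists_append₃ (p := q) (j := k) (b := j - 1 - q)
    (hs.trans (by omega))
  have e₁ : u ++ ((x ++ (y ++ z)) ++ t) = (u ++ x) ++ (y ++ (z ++ t)) := by simp
  have e₂ : (u ++ x) ++ wordProd C y :: (z ++ t) = u ++ ((x ++ wordProd C y :: z) ++ t) := by simp
  have l₁ : ((u ++ x) ++ wordProd C y :: (z ++ t)).length = ij := by simp; omega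
  have l₂ : (x ++ wordProd C y :: z).length = j := by simp; omega
  have l₃ (b : C) : (u ++ b :: t).length = i := by simp; omega
  rw [Cochain.eval_comp c (e.comp q f hq hjk) hp h' u (x ++ (y ++ z)) t hu hs hw (l₃ _),
    Cochain.eval_comp e f hq hjk x y z hx hy hs l₂, Cochain.eval_reindex _ e₁ hw,
    Cochain.eval_comp (c.comp p e hp hij) f hpq h (u ++ x) y (z ++ t) (by simp; omega) hy _ l₁,
    Cochain.eval_reindex _ e₂ l₁,
    Cochain.eval_comp c e hp hij u (x ++ wordProd C y :: z) t hu l₂ _ (l₃ _)]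
  have hD := wordApply_wordApply (r := F.obj) x y z t (a := wordProd C y)
    (b := wordProd C (x ++ wordProd C y :: z)) (f.eval y hy) (e.eval _ l₂) u e₁ e₂
  have hC := wordGroup_wordGroup u x y z t e₁ e₂
  have hL := wordApply_comp_letter (r := F.obj) (x ++ (y ++ z)) t
    (a := wordProd C (x ++ wordProd C y :: z)) (b := wordProd C (x ++ (y ++ z)))
    (wordApply (r := F.obj) x y z (b := wordProd C y) (f.eval y hy) ≫ e.eval _ l₂)
    (F.map (wordGroup x y z).inv) u
  have hN := c.eval_letter u t (wordGroup x y z).inv (l₃ _) (l₃ _)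
  rw [Category.assoc] at hL
  rw [hL]
  simp only [Category.assoc]
  rw [reassoc_of% hN, ← reassoc_of% hD]
  simp only [← F.map_comp, hC]

/-- Insertions into different slots commute. -/
theorem Cochain.comp_comm {i j k ij ik n p q : ℕ} (c : Cochain F i) (e : Cochain F j)
    (f : Cochain F k) (hp : p < i) (hpq : p ≤ q) (hq : q + 1 < i) (hij : i + j = ij + 1)
    (hik : i + k = ik + 1) (h : ij + k = n + 1) (h' : ik + j = n + 1) (hq' : q + j < ij)
    (hp' : p < ik) :
    (c.comp p e hp hij).comp (q + j) f hq' h = (c.comp (q + 1) f hq hik).comp p e hp' h' := by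
  refine Cochain.ext_eval fun w hw => ?_
  obtain ⟨u, y, s', rfl, hu, hy, hs'⟩ := exists_append₃ (p := p) (j := j) (b := ik - 1 - p)
    (hw.trans (by omega))
  obtain ⟨s, v, t, rfl, hs, hv, ht⟩ := exists_append₃ (p := q - p) (j := k) (b := i - q - 2)
    (hs'.trans (by omega))
  have e₁ : u ++ wordProd C y :: (s ++ (v ++ t)) = (u ++ wordProd C y :: s) ++ (v ++ t) := by simp
  have e₂ : u ++ (y ++ (s ++ (v ++ t))) = (u ++ (y ++ s)) ++ (v ++ t) := by simp
  have e₃ : (u ++ (y ++ s)) ++ wordProd C v :: t = u ++ (y ++ (s ++ wordProd C v :: t)) := by simp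
  have e₄ : u ++ wordProd C y :: (s ++ wordProd C v :: t) =
      (u ++ wordProd C y :: s) ++ wordProd C v :: t := by simp
  have l₁ : (u ++ wordProd C y :: (s ++ (v ++ t))).length = ik := by simp; omega
  have l₂ : ((u ++ (y ++ s)) ++ wordProd C v :: t).length = ij := by simp; omega
  have l₃ : (u ++ wordProd C y :: (s ++ wordProd C v :: t)).length = i := by simp; omega
  rw [Cochain.eval_comp (c.comp (q + 1) f hq hik) e hp' h' u y (s ++ (v ++ t)) hu hy hw l₁,
    Cochain.eval_reindex _ e₁ l₁,
    Cochain.eval_comp c f hq hik (u ++ wordProd C y :: s) v t (by simp; omega) hv _ (e₄ ▸ l₃),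
    Cochain.eval_reindex _ e₂ hw,
    Cochain.eval_comp (c.comp p e hp hij) f hq' h (u ++ (y ++ s)) v t (by simp; omega) hv _ l₂,
    Cochain.eval_reindex _ e₃ l₂,
    Cochain.eval_comp c e hp hij u y (s ++ wordProd C v :: t) hu hy _ l₃,
    Cochain.eval_reindex c e₄ l₃]
  have hD := wordApply_comm (r := F.obj) y s v t (a := wordProd C y) (b := wordProd C v)
    (e.eval y hy) (f.eval v hv) u e₁ e₂ e₃ e₄
  have hC := wordGroup_comm u y s v t e₁ e₂ e₃ e₄
  simp only [Category.assoc, ← F.map_comp]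
  rw [hC, reassoc_of% hD]

end MonoidalHochschild

/-! ### Units and multiplication -/

namespace MonoidalHochschild

variable {C : Type u} [Category.{v} C] [MonoidalCategory C]
  {D : Type u'} [Category.{v'} D] [MonoidalCategory D] {F : C ⥤ D}

theorem eval_idCochain (x : C) (h : [x].length = 1) :
    (idCochain F).eval [x] h = (ρ_ (F.obj x)).hom ≫ F.map (ρ_ x).inv := rfl

theorem Cochain.comp_id {i p : ℕ} (c : Cochain F i) (hp : p < i) (h : i + 1 = i + 1) :
    c.comp p (idCochain F) hp h = c := by
  refine Cochain.ext_eval fun w hw => ?_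
  obtain ⟨u, s, t, rfl, hu, hs, ht⟩ := exists_append₃ (p := p) (j := 1) (b := i - 1 - p)
    (hw.trans (by omega))
  obtain ⟨x, rfl⟩ := List.length_eq_one_iff.1 hs
  have l (b : C) : (u ++ b :: t).length = i := by simp; omega
  rw [Cochain.eval_comp c (idCochain F) hp h u [x] t hu hs hw (l _)]
  have h₁ := wordApply_comp_letter (r := F.obj) [x] t (a := x) (b := wordProd C [x])
    (ρ_ (F.obj x)).hom (F.map (ρ_ x).inv) u
  have h₂ := wordApply_comp_letter (r := fun x : C => x) [x] t (a := x) (b := wordProd C [x])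
    (ρ_ x).hom (ρ_ x).inv u
  have h₃ := c.eval_letter u t (a := x) (b := wordProd C [x]) (ρ_ x).inv (l _) (l _)
  have h₄ : (wordGroup u [x] t).hom =
      wordLetter (r := fun x : C => x) u t (a := x) (b := wordProd C [x]) (ρ_ x).inv := by
    rw [wordApply_singleton] at h₂
    refine (wordGroup_hom [x] t u).trans (Eq.trans ?_ (h₂.trans (Category.id_comp _)))
    exact congrArg (wordApply (r := fun x : C => x) u [x] t (b := wordProd C [x]))
      (ρ_ x).hom_inv_id.symm
  have h₅ : wordLetter (r := fun x : C => x) u t (a := x) (b := wordProd C [x]) (ρ_ x).inv ≫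
      (wordGroup u [x] t).inv = 𝟙 _ := by
    rw [← h₄]
    exact Iso.hom_inv_id _
  rw [wordApply_singleton] at h₁
  rw [eval_idCochain]
  have key : c.eval (u ++ x :: t) (l x) ≫
      F.map (wordLetter (r := fun x : C => x) u t (a := x) (b := wordProd C [x]) (ρ_ x).inv) ≫
        F.map (wordGroup u [x] t).inv = c.eval (u ++ x :: t) (l x) := by
    rw [← F.map_comp, h₅, F.map_id, Category.comp_id]
  refine Eq.trans ?_ key
  rw [← reassoc_of% h₃]
  refine (congrArg (fun f => f ≫ c.eval (u ++ wordProd C [x] :: t) (l _) ≫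
    F.map (wordGroup u [x] t).inv) h₁).trans ?_
  rw [Category.assoc]
  exact Category.id_comp _

/-- The composite of canonical isomorphisms that results from inserting `c` into the identity
cochain is trivial. -/
theorem id_comp_aux (F : C ⥤ D) {P P' : D} {Q Q' : C} {a : P ⟶ P'} {a' : P' ⟶ P}
    {σ : P' ≅ P ⊗ 𝟙_ D} {σ' : Q' ≅ Q ⊗ 𝟙_ C} {b : Q' ⟶ Q} (ha : a ≫ a' = 𝟙 P)
    (hD : σ.hom ≫ (ρ_ P).hom = a') (hC : σ'.hom ≫ (ρ_ Q).hom = b) (c : P ⟶ F.obj Q) :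
    a ≫ ((σ.hom ≫ c ▷ 𝟙_ D) ≫ ((ρ_ (F.obj Q)).hom ≫ F.map (ρ_ Q).inv) ≫ F.map σ'.inv) ≫
      F.map b = c := by
  subst hC hD
  have h₁ : F.map (ρ_ Q).inv ≫ F.map σ'.inv ≫ F.map (σ'.hom ≫ (ρ_ Q).hom) = 𝟙 _ := by
    rw [← F.map_comp, ← F.map_comp]
    simp
  simp only [Category.assoc]
  rw [h₁, Category.comp_id, rightUnitor_naturality, ← Category.assoc σ.hom, ← Category.assoc a, ha,
    Category.id_comp]

theorem Cochain.id_comp {k : ℕ} (c : Cochain F k) (hp : 0 < 1) (h : 1 + k = k + 1) :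
    (idCochain F).comp 0 c hp h = c := by
  refine Cochain.ext_eval fun s hs => ?_
  have e : s = [] ++ (s ++ []) := by simp
  rw [Cochain.eval_reindex _ e hs,
    Cochain.eval_comp (idCochain F) c hp h [] s [] rfl hs _ rfl]
  exact id_comp_aux F (reindex_trans F.obj e (List.append_nil s))
    (wordSplit_nil F.obj s (List.append_nil s)) (wordSplit_nil (fun x : C => x) s (List.append_nil s))
    (c.eval s hs)

theorem hom_heq_hom {E : Type*} [Category E] {P P' Q Q' : E} (hP : P = P') (hQ : Q = Q')
    {f : P ≅ Q} {f' : P' ≅ Q'} (hf : f ≍ f') : f.hom ≍ f'.hom := by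
  subst hP hQ hf
  rfl

variable [F.LaxMonoidal]

theorem mu_heq {A A' B B' : C} (hA : A = A') (hB : B = B') :
    Functor.LaxMonoidal.μ F A B ≍ Functor.LaxMonoidal.μ F A' B' := by
  subst hA hB
  rfl

theorem tensorHom_heq {P P' Q Q' R R' S S' : D} (hP : P = P') (hQ : Q = Q') (hR : R = R')
    (hS : S = S') {f : P ⟶ Q} {f' : P' ⟶ Q'} {g : R ⟶ S} {g' : R' ⟶ S'} (hf : f ≍ f')
    (hg : g ≍ g') : (f ⊗ₘ g) ≍ (f' ⊗ₘ g') := by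
  subst hP hQ hR hS hf hg
  rfl

theorem eval_juxt {i j n : ℕ} (c : Cochain F i) (e : Cochain F j) (h : j + i = n) (s t : List C)
    (hs : s.length = i) (ht : t.length = j) (hw : (s ++ t).length = n) :
    ((juxt c e).cast h).eval (s ++ t) hw = (wordSplit F.obj s t).hom ≫
      (c.eval s hs ⊗ₘ e.eval t ht) ≫ Functor.LaxMonoidal.μ F (wordProd C s) (wordProd C t) ≫
        F.map (wordSplit (fun x : C => x) s t).inv := by
  subst hs ht h
  have f₁ := firstArgs_letters (b := t.length) (j := s.length) (fun x : C => x) s t hw rfl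
  have l₁ := lastArgs_letters (b := t.length) (j := s.length) (fun x : C => x) s t hw rfl rfl
  have f₂ := congrArg (tensorPower D _).obj
    (firstArgs_letters (b := t.length) (j := s.length) F.obj s t hw rfl)
  have l₂ := congrArg (tensorPower D _).obj
    (lastArgs_letters (b := t.length) (j := s.length) F.obj s t hw rfl rfl)
  have f₃ := congrArg (tensorPower C _).obj f₁
  have l₃ := congrArg (tensorPower C _).obj l₁
  have w₁ := tensorPower_letters (fun x : C => x) (s ++ t) hw
  have w₂ := tensorPower_letters F.obj (s ++ t) hw
  have hfl := congrArg₂ (fun X Y : C => X ⊗ Y) f₃ l₃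
  have hfl₂ := congrArg₂ (fun X Y : D => X ⊗ Y) f₂ l₂
  have hFfl := congrArg₂ (fun X Y : C => F.obj X ⊗ F.obj Y) f₃ l₃
  refine eq_of_heq ((Cochain.eval_heq _ _ hw).symm.trans ?_)
  exact comp_heq_comp w₂ hfl₂ (congrArg F.obj w₁)
    (hom_heq_hom w₂ hfl₂ (splitIso_heq_wordSplit F.obj t s hw))
    (comp_heq_comp hfl₂ hFfl (congrArg F.obj w₁)
      (tensorHom_heq f₂ (congrArg F.obj f₃) l₂ (congrArg F.obj l₃) (c.app_heq f₁) (e.app_heq l₁))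
      (comp_heq_comp hFfl (congrArg F.obj hfl) (congrArg F.obj w₁) (mu_heq f₃ l₃)
        (map_heq_map F hfl w₁ (inv_heq_inv w₁ hfl
          (splitIso_heq_wordSplit (fun x : C => x) t s hw)))))

/-- The canonical isomorphisms around `c` and `e` cancel after their insertion into `μ`. -/
theorem mul_comp_aux (F : C ⥤ D) [F.LaxMonoidal] {R W P P' : D} {S V Q Q' : C} {a : P ⟶ P'}
    {a' : P' ⟶ P} {σ : P' ≅ P ⊗ 𝟙_ D} {σ' : Q' ≅ Q ⊗ 𝟙_ C} {b : Q' ⟶ Q} (ha : a ≫ a' = 𝟙 P)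
    (hD : σ.hom ≫ (ρ_ P).hom = a') (hC : σ'.hom ≫ (ρ_ Q).hom = b) (τ : W ⟶ R ⊗ P)
    (τ' : S ⊗ Q ⟶ V) (c : R ⟶ F.obj S) (e : P ⟶ F.obj Q) :
    (τ ≫ c ▷ P) ≫ (F.obj S ◁ a ≫ (F.obj S ◁ (σ.hom ≫ e ▷ 𝟙_ D) ≫
      (F.obj S ◁ (ρ_ (F.obj Q)).hom ≫ Functor.LaxMonoidal.μ F S Q ≫ F.map (S ◁ (ρ_ Q).inv)) ≫
        F.map (S ◁ σ'.inv)) ≫ F.map (S ◁ b)) ≫ F.map τ' =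
      τ ≫ (c ⊗ₘ e) ≫ Functor.LaxMonoidal.μ F S Q ≫ F.map τ' := by
  subst hC hD
  have h₁ : F.map (S ◁ (ρ_ Q).inv) ≫ F.map (S ◁ σ'.inv) ≫ F.map (S ◁ (σ'.hom ≫ (ρ_ Q).hom)) =
      𝟙 _ := by
    rw [← F.map_comp, ← F.map_comp, ← whiskerLeft_comp, ← whiskerLeft_comp]
    simp
  have h₂ : F.obj S ◁ a ≫ F.obj S ◁ (σ.hom ≫ e ▷ 𝟙_ D) ≫ F.obj S ◁ (ρ_ (F.obj Q)).hom =
      F.obj S ◁ e := by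
    rw [← whiskerLeft_comp, ← whiskerLeft_comp, Category.assoc, rightUnitor_naturality,
      ← Category.assoc σ.hom, ← Category.assoc a, ha, Category.id_comp]
  simp only [Category.assoc]
  rw [reassoc_of% h₁, reassoc_of% h₂, MonoidalCategory.tensorHom_def]
  simp

/-- The product `μ (c, e)` of cochains is obtained from `μ` by two insertions. -/
theorem mul_comp_comp {i j k n : ℕ} (c : Cochain F i) (e : Cochain F j) (hp : 1 < 2)
    (h : 2 + j = k + 1) (hp' : 0 < k) (h' : k + i = n + 1) (hn : j + i = n) :
    ((mulCochain F).comp 1 e hp h).comp 0 c hp' h' = (juxt c e).cast hn := by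
  refine Cochain.ext_eval fun w hw => ?_
  obtain ⟨s, t, hst, hs, ht⟩ : ∃ s t : List C, w = s ++ t ∧ s.length = i ∧ t.length = j :=
    ⟨w.take i, w.drop i, by simp, by simp; omega, by simp; omega⟩
  subst hst
  have e₁ : wordProd C s :: t = [wordProd C s] ++ (t ++ []) := by simp
  have l₁ : (wordProd C s :: t).length = k := by simp; omega
  rw [eval_juxt c e hn s t hs ht hw]
  refine (Cochain.eval_comp _ c hp' h' [] s t rfl hs hw l₁).trans ?_
  have h₁ := Cochain.eval_reindex ((mulCochain F).comp 1 e hp h) e₁ l₁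
  rw [Cochain.eval_comp (mulCochain F) e hp h [wordProd C s] t [] rfl ht _ rfl,
    reindex_cons F.obj (wordProd C s) (List.append_nil t).symm e₁,
    reindex_cons (fun x : C => x) (wordProd C s) (List.append_nil t) e₁.symm] at h₁
  refine (congrArg (fun f => wordApply (r := F.obj) [] s t (b := wordProd C s) (c.eval s hs) ≫
    f ≫ F.map (wordSplit (fun x : C => x) s t).inv) h₁).trans ?_
  exact mul_comp_aux F (reindex_trans F.obj (List.append_nil t).symm (List.append_nil t))
    (wordSplit_nil F.obj t (List.append_nil t)) (wordSplit_nil (fun x : C => x) t (List.append_nil t))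
    (wordSplit F.obj s t).hom (wordSplit (fun x : C => x) s t).inv (c.eval s hs) (e.eval t ht)

theorem tensorHom_whiskerRight_comp {P Q R S P' R' S' : D} (f : P ⟶ Q) (g : Q ⟶ R) (k : R ⟶ S)
    (f' : P' ⟶ R') (k' : R' ⟶ S') :
    ((f ≫ g ≫ k) ⊗ₘ (f' ≫ k')) = (f ⊗ₘ f') ≫ g ▷ R' ≫ (k ⊗ₘ k') := by
  simp [MonoidalCategory.tensorHom_def, whisker_exchange_assoc]

theorem tensorHom_whiskerLeft_comp {P Q R S P' R' S' : D} (f' : P' ⟶ R') (k' : R' ⟶ S')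
    (f : P ⟶ Q) (g : Q ⟶ R) (k : R ⟶ S) :
    ((f' ≫ k') ⊗ₘ (f ≫ g ≫ k)) = (f' ⊗ₘ f) ≫ R' ◁ g ≫ (k' ⊗ₘ k) := by
  simp [MonoidalCategory.tensorHom_def, whisker_exchange_assoc]

/-- Associativity of the multiplication `μ`. -/
theorem juxt_mul_id (h : 1 + 2 = 3) (h' : 2 + 1 = 3) :
    (juxt (mulCochain F) (idCochain F)).cast h = (juxt (idCochain F) (mulCochain F)).cast h' := by
  refine Cochain.ext_eval fun w hw => ?_
  obtain ⟨x, y, z, rfl⟩ := List.length_eq_three.1 hw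
  refine (eval_juxt (mulCochain F) (idCochain F) h [x, y] [z] rfl rfl hw).trans
    (Eq.trans ?_ (eval_juxt (idCochain F) (mulCochain F) h' [x] [y, z] rfl rfl hw).symm)
  have e (X Y Z : C) : (F.obj X ◁ (F.obj Y ◁ (λ_ (F.obj Z ⊗ 𝟙_ D)).inv ≫ (α_ _ _ _).inv) ≫
      (α_ _ _ _).inv) ≫ ((F.obj X ◁ (ρ_ (F.obj Y)).hom ≫ Functor.LaxMonoidal.μ F X Y ≫
        F.map (X ◁ (ρ_ Y).inv)) ⊗ₘ ((ρ_ (F.obj Z)).hom ≫ F.map (ρ_ Z).inv)) ≫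
        Functor.LaxMonoidal.μ F (X ⊗ Y ⊗ 𝟙_ C) (Z ⊗ 𝟙_ C) ≫
          F.map ((α_ _ _ _).hom ≫ X ◁ ((α_ _ _ _).hom ≫ Y ◁ (λ_ (Z ⊗ 𝟙_ C)).hom)) =
      (F.obj X ◁ (λ_ (F.obj Y ⊗ F.obj Z ⊗ 𝟙_ D)).inv ≫ (α_ _ _ _).inv) ≫
        (((ρ_ (F.obj X)).hom ≫ F.map (ρ_ X).inv) ⊗ₘ (F.obj Y ◁ (ρ_ (F.obj Z)).hom ≫
          Functor.LaxMonoidal.μ F Y Z ≫ F.map (Y ◁ (ρ_ Z).inv))) ≫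
        Functor.LaxMonoidal.μ F (X ⊗ 𝟙_ C) (Y ⊗ Z ⊗ 𝟙_ C) ≫
          F.map ((α_ _ _ _).hom ≫ X ◁ (λ_ (Y ⊗ Z ⊗ 𝟙_ C)).hom) := by
    -- both sides become the product of three factors, with its two bracketings
    have hl : ((F.obj X ◁ (ρ_ (F.obj Y)).hom ≫ Functor.LaxMonoidal.μ F X Y ≫
        F.map (X ◁ (ρ_ Y).inv)) ⊗ₘ ((ρ_ (F.obj Z)).hom ≫ F.map (ρ_ Z).inv)) =
        (F.obj X ◁ (ρ_ (F.obj Y)).hom ⊗ₘ (ρ_ (F.obj Z)).hom) ≫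
          Functor.LaxMonoidal.μ F X Y ▷ F.obj Z ≫ (F.map (X ◁ (ρ_ Y).inv) ⊗ₘ F.map (ρ_ Z).inv) := by
      exact tensorHom_whiskerRight_comp _ _ _ _ _
    have hr : (((ρ_ (F.obj X)).hom ≫ F.map (ρ_ X).inv) ⊗ₘ (F.obj Y ◁ (ρ_ (F.obj Z)).hom ≫
          Functor.LaxMonoidal.μ F Y Z ≫ F.map (Y ◁ (ρ_ Z).inv))) =
        ((ρ_ (F.obj X)).hom ⊗ₘ F.obj Y ◁ (ρ_ (F.obj Z)).hom) ≫
          F.obj X ◁ Functor.LaxMonoidal.μ F Y Z ≫ (F.map (ρ_ X).inv ⊗ₘ F.map (Y ◁ (ρ_ Z).inv)) := by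
      exact tensorHom_whiskerLeft_comp _ _ _ _ _
    have cl : (F.obj X ◁ (F.obj Y ◁ (λ_ (F.obj Z ⊗ 𝟙_ D)).inv ≫ (α_ _ _ _).inv) ≫
        (α_ _ _ _).inv) ≫ (F.obj X ◁ (ρ_ (F.obj Y)).hom ⊗ₘ (ρ_ (F.obj Z)).hom) =
        F.obj X ◁ F.obj Y ◁ (ρ_ (F.obj Z)).hom ≫ (α_ _ _ _).inv := by
      monoidal
    have cr : (F.obj X ◁ (λ_ (F.obj Y ⊗ F.obj Z ⊗ 𝟙_ D)).inv ≫ (α_ _ _ _).inv) ≫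
        ((ρ_ (F.obj X)).hom ⊗ₘ F.obj Y ◁ (ρ_ (F.obj Z)).hom) =
        F.obj X ◁ F.obj Y ◁ (ρ_ (F.obj Z)).hom := by
      monoidal
    have dl : (X ◁ (ρ_ Y).inv ⊗ₘ (ρ_ Z).inv) ≫
        (α_ _ _ _).hom ≫ X ◁ ((α_ _ _ _).hom ≫ Y ◁ (λ_ (Z ⊗ 𝟙_ C)).hom) =
        (α_ _ _ _).hom ≫ X ◁ Y ◁ (ρ_ Z).inv := by
      monoidal
    have dr : ((ρ_ X).inv ⊗ₘ Y ◁ (ρ_ Z).inv) ≫ (α_ _ _ _).hom ≫ X ◁ (λ_ (Y ⊗ Z ⊗ 𝟙_ C)).hom =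
        X ◁ Y ◁ (ρ_ Z).inv := by
      monoidal
    rw [hl, hr]
    simp only [Category.assoc] at cl cr ⊢
    rw [reassoc_of% cl, reassoc_of% cr,
      Functor.LaxMonoidal.μ_natural_assoc,
      Functor.LaxMonoidal.μ_natural_assoc, ← F.map_comp, ← F.map_comp, dl, dr, F.map_comp,
      Functor.LaxMonoidal.associativity_assoc, Iso.inv_hom_id_assoc]
  exact e x y z

theorem juxt_unit_id (h : 1 + 0 = 1) :
    (juxt (unitCochain F) (idCochain F)).cast h = idCochain F := by
  refine Cochain.ext_eval fun w hw => ?_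
  obtain ⟨x, rfl⟩ := List.length_eq_one_iff.1 hw
  refine (eval_juxt (unitCochain F) (idCochain F) h [] [x] rfl rfl hw).trans ?_
  have e (X : C) : (λ_ (F.obj X ⊗ 𝟙_ D)).inv ≫ (Functor.LaxMonoidal.ε F ⊗ₘ
      ((ρ_ (F.obj X)).hom ≫ F.map (ρ_ X).inv)) ≫ Functor.LaxMonoidal.μ F (𝟙_ C) (X ⊗ 𝟙_ C) ≫
        F.map (λ_ (X ⊗ 𝟙_ C)).hom = (ρ_ (F.obj X)).hom ≫ F.map (ρ_ X).inv := by
    rw [MonoidalCategory.tensorHom_def', Category.assoc, ← Functor.LaxMonoidal.left_unitality]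
    simp
  exact e x

theorem juxt_id_unit (h : 0 + 1 = 1) :
    (juxt (idCochain F) (unitCochain F)).cast h = idCochain F := by
  refine Cochain.ext_eval fun w hw => ?_
  obtain ⟨x, rfl⟩ := List.length_eq_one_iff.1 hw
  refine (eval_juxt (idCochain F) (unitCochain F) h [x] [] rfl rfl hw).trans ?_
  have e (X : C) : (F.obj X ◁ (λ_ (𝟙_ D)).inv ≫ (α_ _ _ _).inv) ≫
      (((ρ_ (F.obj X)).hom ≫ F.map (ρ_ X).inv) ⊗ₘ Functor.LaxMonoidal.ε F) ≫
        Functor.LaxMonoidal.μ F (X ⊗ 𝟙_ C) (𝟙_ C) ≫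
          F.map ((α_ _ _ _).hom ≫ X ◁ (λ_ (𝟙_ C)).hom) =
        (ρ_ (F.obj X)).hom ≫ F.map (ρ_ X).inv := by
    have h₁ : (α_ X (𝟙_ C) (𝟙_ C)).hom ≫ X ◁ (λ_ (𝟙_ C)).hom = (ρ_ (X ⊗ 𝟙_ C)).hom := by
      simp
    rw [h₁, MonoidalCategory.tensorHom_def, Category.assoc, Category.assoc,
      ← Functor.LaxMonoidal.right_unitality]
    simp
  exact e x

theorem mul_comp_zero {i n : ℕ} (c : Cochain F i) (hp : 0 < 2) (h : 2 + i = n + 1)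
    (hn : 1 + i = n) : (mulCochain F).comp 0 c hp h = (juxt c (idCochain F)).cast hn := by
  rw [← mul_comp_comp c (idCochain F) one_lt_two rfl two_pos h hn, Cochain.comp_id]

theorem mul_comp_one {i n : ℕ} (c : Cochain F i) (hp : 1 < 2) (h : 2 + i = n + 1)
    (hn : i + 1 = n) : (mulCochain F).comp 1 c hp h = (juxt (idCochain F) c).cast hn := by
  rw [← mul_comp_comp (idCochain F) c hp h (by omega) rfl hn, Cochain.comp_id]

end MonoidalHochschild

/-! ### The signed operad of cochains -/

namespace MonoidalHochschild

variable {C : Type u} [Category.{v} C] [MonoidalCategory C]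
  {D : Type u'} [Category.{v'} D] [Preadditive D] [MonoidalCategory D] {F : C ⥤ D}

theorem Cochain.comp_add_left {i j n p : ℕ} (c c' : Cochain F i) (e : Cochain F j) (hp : p < i)
    (h : i + j = n + 1) : (c + c').comp p e hp h = c.comp p e hp h + c'.comp p e hp h := by
  simp only [Cochain.comp, Cochain.cast_add, insert_add_left]

open DirectSum

variable (F) in
/-- The direct sum of the groups of cochains. -/
abbrev TotalCochain := ⨁ n, Cochain F n

variable (F) in
/-- The inclusion of the cochains of degree `n`. -/
abbrev total (n : ℕ) : Cochain F n →+ TotalCochain F := DirectSum.of (fun n => Cochain F n) n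

theorem total_injective (n : ℕ) : Function.Injective (total F n) := DirectSum.of_injective n

theorem total_comp {i j m n : ℕ} (p : ℕ) (c : Cochain F i) (e : Cochain F j) (hp : p < i)
    (hm : i + j = m + 1) (hn : i + j = n + 1) :
    total F m (c.comp p e hp hm) = total F n (c.comp p e hp hn) := by
  obtain rfl : m = n := by omega
  rfl

variable [MonoidalPreadditive D]

theorem applyAt_add (b : ℕ) {j : ℕ} (e e' : Cochain F j) : (p : ℕ) → (X : Fin (b + j + p) → C) →
    applyAt b (e + e') p X = applyAt b e p X + applyAt b e' p X
  | 0, X => by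
    have h {P Q R S : D} (s : P ⟶ Q ⊗ R) (a a' : Q ⟶ S) :
        s ≫ (a + a') ▷ R = s ≫ a ▷ R + s ≫ a' ▷ R := by
      simp [MonoidalPreadditive.add_whiskerRight]
    exact h _ _ _
  | p + 1, X => by
    refine (congrArg (fun f => F.obj (X 0) ◁ f) (applyAt_add b e e' p _)).trans ?_
    exact MonoidalPreadditive.whiskerLeft_add _ _

theorem Cochain.comp_add_right {i j n p : ℕ} (c : Cochain F i) (e e' : Cochain F j) (hp : p < i)
    (h : i + j = n + 1) : c.comp p (e + e') hp h = c.comp p e hp h + c.comp p e' hp h := by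
  simp only [Cochain.comp, ← Cochain.cast_add]
  congr 1
  ext X
  exact (congrArg (fun f => f ≫ _) (applyAt_add _ e e' p X)).trans (Preadditive.add_comp _ _ _ _ _ _)

/-- Insertion as a biadditive map. -/
def Cochain.compHom {i j n : ℕ} (p : ℕ) (hp : p < i) (h : i + j = n + 1) :
    Cochain F i →+ Cochain F j →+ Cochain F n :=
  AddMonoidHom.mk' (fun c => AddMonoidHom.mk' (fun e => c.comp p e hp h)
    (fun e e' => Cochain.comp_add_right c e e' hp h))
    (fun c c' => AddMonoidHom.ext fun e => Cochain.comp_add_left c c' e hp h)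

variable (F) in
/-- The signed insertion of cochains of degree `j` into cochains of degree `i`, and zero if there
is no slot number `p + 1`. -/
def signedInsert (p i j : ℕ) : Cochain F i →+ Cochain F j →+ TotalCochain F :=
  if hp : p < i then (((j : ℤ) - 1) * p).negOnePow •
    (Cochain.compHom p hp (show i + j = i + j - 1 + 1 by omega)).compr₂ (total F (i + j - 1))
  else 0

variable (F) in
/-- The signed insertion on the direct sum. -/
def totalInsert (p : ℕ) : TotalCochain F →+ TotalCochain F →+ TotalCochain F :=
  DirectSum.toAddMonoid fun i => (DirectSum.toAddMonoid fun j => (signedInsert F p i j).flip).flip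

theorem totalInsert_total {i j n p : ℕ} (c : Cochain F i) (e : Cochain F j) (hp : p < i)
    (h : i + j = n + 1) : totalInsert F p (total F i c) (total F j e) =
      (((j : ℤ) - 1) * p).negOnePow • total F n (c.comp p e hp h) := by
  rw [totalInsert, DirectSum.toAddMonoid_of, AddMonoidHom.flip_apply, DirectSum.toAddMonoid_of,
    AddMonoidHom.flip_apply, signedInsert, dif_pos hp, total_comp p c e hp h (show i + j = i + j - 1 + 1 by omega)]
  simp only [Units.smul_def, AddMonoidHom.smul_apply]
  rfl

variable (F) [F.LaxMonoidal]

/-- The operad of cochains of a lax monoidal functor, with multiplication `μ` and unit `η`. -/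
def operad : SignedOperad (TotalCochain F) where
  H n := (total F n).range
  ins := totalInsert F
  ins_mem := by
    rintro i j p _ _ ⟨c, rfl⟩ ⟨e, rfl⟩ hp
    rw [totalInsert_total c e (by omega) (show i + 1 + j = i + j + 1 by omega)]
    exact zsmul_mem (AddMonoidHom.mem_range.2 ⟨_, rfl⟩) _
  ins_ins := by
    rintro i j k p q _ _ _ ⟨c, rfl⟩ ⟨e, rfl⟩ ⟨f, rfl⟩ hp hq
    rw [totalInsert_total c e hp (show i + j = i + j - 1 + 1 by omega),
      totalInsert_total e f hq (show j + k = j + k - 1 + 1 by omega)]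
    simp only [Units.smul_def, map_zsmul, AddMonoidHom.smul_apply]
    rw [totalInsert_total _ f (show p + q < i + j - 1 by omega)
        (show i + j - 1 + k = i + j + k - 2 + 1 by omega),
      totalInsert_total c _ hp (show i + (j + k - 1) = i + j + k - 2 + 1 by omega),
      Cochain.comp_assoc (jk := j + k - 1) c e f hp hq _ (by omega) _ (by omega)]
    simp only [← Units.smul_def, smul_smul, ← Int.negOnePow_add]
    congr 2
    rw [Nat.cast_sub (by omega)]
    push_cast
    ring
  ins_comm := by
    rintro i j k p q _ _ _ ⟨c, rfl⟩ ⟨e, rfl⟩ ⟨f, rfl⟩ hp hq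
    rw [totalInsert_total c e (by omega) (show i + j = i + j - 1 + 1 by omega),
      totalInsert_total c f hq (show i + k = i + k - 1 + 1 by omega)]
    simp only [koszul, Units.smul_def, map_zsmul, AddMonoidHom.smul_apply]
    rw [totalInsert_total _ f (show q + j < i + j - 1 by omega)
        (show i + j - 1 + k = i + j + k - 2 + 1 by omega),
      totalInsert_total _ e (show p < i + k - 1 by omega)
        (show i + k - 1 + j = i + j + k - 2 + 1 by omega),
      Cochain.comp_comm (ik := i + k - 1) c e f (by omega) hp hq _ (by omega) _ (by omega) _ (by omega)]
    simp only [← Units.smul_def, smul_smul, ← Int.negOnePow_add]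
    congr 2
    push_cast
    ring
  id := total F 1 (idCochain F)
  mul := total F 2 (mulCochain F)
  unit := total F 0 (unitCochain F)
  id_mem := ⟨_, rfl⟩
  mul_mem := ⟨_, rfl⟩
  unit_mem := ⟨_, rfl⟩
  ins_id := by
    rintro k _ ⟨c, rfl⟩
    rw [totalInsert_total (idCochain F) c one_pos (Nat.add_comm 1 k), Cochain.id_comp]
    simp
  mul_assoc := by
    rw [totalInsert_total (mulCochain F) (mulCochain F) one_lt_two (show 2 + 2 = 3 + 1 from rfl),
      totalInsert_total (mulCochain F) (mulCochain F) two_pos (show 2 + 2 = 3 + 1 from rfl),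
      mul_comp_zero _ _ _ rfl, mul_comp_one _ _ _ rfl, juxt_mul_id rfl rfl]
    simp
  mul_unit := by
    rw [totalInsert_total (mulCochain F) (unitCochain F) one_lt_two (show 2 + 0 = 1 + 1 from rfl),
      mul_comp_one _ _ _ rfl, juxt_id_unit]
    simp
  unit_mul := by
    rw [totalInsert_total (mulCochain F) (unitCochain F) two_pos (show 2 + 0 = 1 + 1 from rfl),
      mul_comp_zero _ _ _ rfl, juxt_unit_id]
    simp

end MonoidalHochschild

/-! ### Comparison of the two cohomologies -/

/-- The transport of a Gerstenhaber algebra structure along isomorphisms in each degree. -/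
def GerstenhaberAlgebra.transport {A : ℤ → Type u} [∀ n, AddCommGroup (A n)] {B : ℤ → Type v}
    [∀ n, AddCommGroup (B n)] (G : GerstenhaberAlgebra B) (e : ∀ n, A n ≃+ B n) :
    GerstenhaberAlgebra A where
  mul {i j n} h := (((G.mul h).compl₂ (e j).toAddMonoidHom).comp (e i).toAddMonoidHom).compr₂
    (e n).symm.toAddMonoidHom
  one := (e 0).symm G.one
  bracket {i j n} h := (((G.bracket h).compl₂ (e j).toAddMonoidHom).comp
    (e i).toAddMonoidHom).compr₂ (e n).symm.toAddMonoidHom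
  one_mul a := by simp [G.one_mul]
  mul_one a := by simp [G.mul_one]
  mul_assoc hij hjk h h' a b c := by simp [G.mul_assoc hij hjk h h']
  mul_comm h h' a b := by simp [G.mul_comm h h', Units.smul_def]
  bracket_antisymm h h' a b := by simp [G.bracket_antisymm h h', Units.smul_def]
  jacobi hij hik hjk h₁ h₂ h₃ a b c := by
    simp [G.jacobi hij hik hjk h₁ h₂ h₃, Units.smul_def]
  leibniz hij hik hjk h₁ h₂ h₃ a b c := by
    simp [G.leibniz hij hik hjk h₁ h₂ h₃, Units.smul_def]

namespace MonoidalHochschild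

variable {C : Type u} [Category.{v} C] [MonoidalCategory C]
  {D : Type u'} [Category.{v'} D] [Preadditive D] [MonoidalCategory D] [MonoidalPreadditive D]
  {F : C ⥤ D} [F.LaxMonoidal]

theorem total_circ {i j n : ℕ} (c : Cochain F i) (e : Cochain F j) (h : i + j = n + 1) :
    total F n (circ c e h) = (operad F).circ i (total F i c) (total F j e) := by
  rw [SignedOperad.circ_apply, Finset.sum_range, circ, map_sum]
  refine Finset.sum_congr rfl fun p _ => ?_
  rw [Units.smul_def, map_zsmul]
  exact (totalInsert_total c e p.2 h).symm

theorem total_bracket {i j n : ℕ} (c : Cochain F i) (e : Cochain F j) (h : i + j = n + 1) :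
    total F n (bracket c e h) = (operad F).lie i j (total F i c) (total F j e) := by
  rw [bracket, SignedOperad.lie, map_sub, Units.smul_def, map_zsmul, total_circ, total_circ]
  rfl

theorem total_cup {i j n : ℕ} (c : Cochain F i) (e : Cochain F j) (h : i + j = n) :
    total F n (cup c e h) = (operad F).cup i j (total F i c) (total F j e) := by
  have h₁ : (operad F).ins 1 (operad F).mul (total F j e) = _ :=
    totalInsert_total (mulCochain F) e one_lt_two (show 2 + j = j + 1 + 1 by omega)
  have h₂ : (operad F).ins 0 (total F (j + 1) _) (total F i c) = _ :=
    totalInsert_total ((mulCochain F).comp 1 e one_lt_two (show 2 + j = j + 1 + 1 by omega)) c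
      j.succ_pos (show j + 1 + i = n + 1 by omega)
  rw [mul_comp_comp c e _ _ _ _ ((Nat.add_comm j i).trans h)] at h₂
  rw [SignedOperad.cup, h₁, Units.smul_def ((((j : ℤ) - 1) * _).negOnePow), map_zsmul,
    AddMonoidHom.smul_apply, h₂, ← Units.smul_def, smul_smul, smul_smul, ← Int.negOnePow_add,
    ← Int.negOnePow_add, cup, Units.smul_def, map_zsmul, ← Units.smul_def]
  congr 1
  rw [show ((i : ℤ) * j + j - 1 + (j - 1) * (1 : ℕ) + (i - 1) * (0 : ℕ)) =
    i * j + 2 * (j - 1) by push_cast; ring, Int.negOnePow_add, Int.negOnePow_two_mul, mul_one]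

theorem circ_mul_total {k : ℕ} (c : Cochain F k) : (operad F).circ 2 (operad F).mul (total F k c) =
    total F (k + 1) ((juxt c (idCochain F)).cast (Nat.add_comm 1 k)) +
      ((k : ℤ) - 1).negOnePow • total F (k + 1) (juxt (idCochain F) c) := by
  have h₀ : (operad F).ins 0 (operad F).mul (total F k c) = _ :=
    totalInsert_total (mulCochain F) c two_pos (show 2 + k = k + 1 + 1 by omega)
  have h₁ : (operad F).ins 1 (operad F).mul (total F k c) = _ :=
    totalInsert_total (mulCochain F) c one_lt_two (show 2 + k = k + 1 + 1 by omega)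
  rw [mul_comp_zero c _ _ (Nat.add_comm 1 k)] at h₀
  rw [mul_comp_one c _ _ rfl] at h₁
  rw [SignedOperad.circ_apply, Finset.sum_range_succ, Finset.sum_range_one, h₀, h₁]
  simp [Cochain.cast_rfl]

/-- In degree zero the two differentials differ by a sign, which affects neither cocycles nor
coboundaries. -/
theorem total_d_zero (c : Cochain F 0) :
    total F 1 (d F 0 c) = -(operad F).δ 0 (total F 0 c) := by
  rw [SignedOperad.δ_eq, circ_mul_total]
  change total F 1 (_ - _) = _
  rw [map_sub, Cochain.cast_rfl]
  simp [SignedOperad.circ, sub_eq_add_neg]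

theorem total_d_succ {k : ℕ} (c : Cochain F (k + 1)) :
    total F (k + 2) (d F (k + 1) c) = (operad F).δ (k + 1) (total F (k + 1) c) := by
  rw [SignedOperad.δ_eq, circ_mul_total, SignedOperad.circ_apply, Finset.sum_range]
  change total F (k + 2) (_ + _ + _) = _
  rw [map_add, map_add, map_sum, Units.smul_def, map_zsmul, Cochain.cast_rfl, ← Units.smul_def,
    Finset.smul_sum, sub_eq_add_neg, ← Finset.sum_neg_distrib]
  have e : ∀ p : Fin (k + 1), total F (k + 2) ((((p : ℕ) : ℤ) + 1 + k).negOnePow •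
        (insert (k - p) 2 p (c.cast (by omega)) (mulCochain F)).cast (by omega)) =
      -((((k + 1 : ℕ) : ℤ) + 1).negOnePow •
        (operad F).ins p (total F (k + 1) c) (operad F).mul) := by
    intro p
    have h : (operad F).ins p (total F (k + 1) c) (operad F).mul = _ :=
      totalInsert_total c (mulCochain F) p.2 (show k + 1 + 2 = k + 2 + 1 by omega)
    rw [h, smul_smul, ← Int.negOnePow_add, ← Units.neg_smul, Units.smul_def, map_zsmul,
      ← Units.smul_def]
    refine congrArg (fun ε : ℤˣ => ε • _) ?_
    rw [← Int.negOnePow_succ, show (((k + 1 : ℕ) : ℤ) + 1 + (((2 : ℕ) : ℤ) - 1) * (p : ℕ) + 1) =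
      (p : ℕ) + 1 + k + 2 * 1 by push_cast; ring, Int.negOnePow_add _ (2 * 1),
      Int.negOnePow_two_mul, mul_one]
  rw [Finset.sum_congr rfl fun p _ => e p]
  push_cast
  rw [add_sub_cancel_right]
  abel

theorem d_eq_zero_iff {k : ℕ} (c : Cochain F k) :
    d F k c = 0 ↔ (operad F).diff k (total F k c) = 0 := by
  rw [SignedOperad.diff_natCast, ← (total_injective _).eq_iff, map_zero]
  cases k with
  | zero => exact (iff_of_eq (congrArg (· = 0) (total_d_zero c))).trans neg_eq_zero
  | succ k => exact iff_of_eq (congrArg (· = 0) (total_d_succ c))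

theorem total_mem_gr {k : ℕ} (c : Cochain F k) : total F k c ∈ (operad F).gr k :=
  SignedOperad.mem_gr_of_mem_H ⟨c, rfl⟩ rfl

theorem mem_cocycles_iff {k : ℕ} {c : Cochain F k} :
    c ∈ cocycles F k ↔ total F k c ∈ (operad F).Z k :=
  (d_eq_zero_iff c).trans (and_iff_right (total_mem_gr c)).symm

theorem mem_coboundaries_iff {k : ℕ} {c : Cochain F k} :
    c ∈ coboundaries F k ↔ total F k c ∈ (operad F).Bd k := by
  cases k with
  | zero =>
    have : (operad F).Bd (0 : ℕ) = ⊥ := by simp [SignedOperad.Bd, SignedOperad.gr]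
    rw [this, AddSubgroup.mem_bot, ← map_zero (total F 0), (total_injective 0).eq_iff]
    exact Iff.rfl
  | succ k =>
    have e : (operad F).Bd (k + 1 : ℕ) = (total F k).range.map ((operad F).diff k) := by
      rw [SignedOperad.Bd, Nat.cast_succ, add_sub_cancel_right, SignedOperad.gr_natCast]
      rfl
    rw [e]
    -- the two differentials have the same image, with `b' = -b` in degree zero
    have hd : ∀ b : Cochain F k, ∃ b' : Cochain F k,
        total F (k + 1) (d F k b) = (operad F).diff k (total F k b') ∧
        total F (k + 1) (d F k b') = (operad F).diff k (total F k b) := by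
      intro b
      cases k with
      | zero =>
        refine ⟨-b, ?_, ?_⟩
        · rw [map_neg, map_neg]
          exact total_d_zero b
        · rw [map_neg, map_neg]
          exact neg_eq_iff_eq_neg.2 (total_d_zero b)
      | succ k => exact ⟨b, total_d_succ b, total_d_succ b⟩
    constructor
    · rintro ⟨b, rfl⟩
      obtain ⟨b', hb, -⟩ := hd b
      exact ⟨_, ⟨b', rfl⟩, hb.symm⟩
    · rintro ⟨_, ⟨b, rfl⟩, hb⟩
      obtain ⟨b', -, hb'⟩ := hd b
      exact ⟨b', total_injective _ (hb'.trans hb)⟩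

theorem d_d (k : ℕ) (c : Cochain F k) : d F (k + 1) (d F k c) = 0 := by
  have h : d F k c ∈ coboundaries F (k + 1) := ⟨c, rfl⟩
  exact mem_cocycles_iff.2 (SignedOperad.Bd_le_Z _ (mem_coboundaries_iff.1 h))

variable (F) in
/-- The inclusion of the cochains, restricted to cocycles. -/
def cocycleHom (k : ℕ) : cocycles F k →+ (operad F).Z k :=
  ((total F k).comp (cocycles F k).subtype).codRestrict _ fun c => mem_cocycles_iff.1 c.2

variable (F) in
/-- The cohomology in a non-negative degree is that of the operad of cochains. -/
noncomputable def cohEquivNat (k : ℕ) :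
    (cocycles F k ⧸ (coboundaries F k).addSubgroupOf (cocycles F k)) ≃+ (operad F).Coh k :=
  AddEquiv.ofBijective
    (QuotientAddGroup.map _ _ (cocycleHom F k) fun _ hc => mem_coboundaries_iff.1 hc) (by
      constructor
      · rw [injective_iff_map_eq_zero]
        intro a ha
        induction a using QuotientAddGroup.induction_on with | H c
        exact (QuotientAddGroup.eq_zero_iff _).2
          (mem_coboundaries_iff.2 ((QuotientAddGroup.eq_zero_iff (cocycleHom F k c)).1 ha))
      · intro a
        induction a using QuotientAddGroup.induction_on with | H z
        obtain ⟨z, hz⟩ := z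
        have hz' := hz.1
        rw [SignedOperad.gr_natCast] at hz'
        obtain ⟨c, rfl⟩ := hz'
        exact ⟨QuotientAddGroup.mk ⟨c, mem_cocycles_iff.2 hz⟩, rfl⟩)

variable (F) in
/-- The Hochschild cohomology is that of the operad of cochains. -/
noncomputable def cohEquiv : (n : ℤ) → HH F n ≃+ (operad F).Coh n
  | .ofNat k => cohEquivNat F k
  | .negSucc k =>
    have : Subsingleton ((operad F).Coh (.negSucc k)) := by
      refine ⟨fun a b => ?_⟩
      induction a using QuotientAddGroup.induction_on with | H x
      induction b using QuotientAddGroup.induction_on with | H y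
      have h : ∀ z : (operad F).Z (.negSucc k), z = 0 := fun z => by
        have := z.2.1
        rw [SignedOperad.gr, if_neg (by omega)] at this
        exact Subtype.ext this
      rw [h x, h y]
    have : Subsingleton (HH F (.negSucc k)) := inferInstanceAs (Subsingleton PUnit)
    { toFun := 0
      invFun := 0
      left_inv := fun _ => Subsingleton.elim _ _
      right_inv := fun _ => Subsingleton.elim _ _
      map_add' := fun _ _ => Subsingleton.elim _ _ }

theorem cup_mem_cocycles {i j n : ℕ} {x : Cochain F i} {y : Cochain F j} (hx : x ∈ cocycles F i)
    (hy : y ∈ cocycles F j) (h : i + j = n) : cup x y h ∈ cocycles F n := by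
  subst h
  rw [mem_cocycles_iff, total_cup, Nat.cast_add]
  exact SignedOperad.cup_mem_Z (mem_cocycles_iff.1 hx) (mem_cocycles_iff.1 hy)

theorem bracket_mem_cocycles {i j n : ℕ} {x : Cochain F i} {y : Cochain F j}
    (hx : x ∈ cocycles F i) (hy : y ∈ cocycles F j) (h : i + j = n + 1) :
    bracket x y h ∈ cocycles F n := by
  rw [mem_cocycles_iff, total_bracket, show (n : ℤ) = i + j - 1 by omega]
  exact SignedOperad.lie_mem_Z (mem_cocycles_iff.1 hx) (mem_cocycles_iff.1 hy)

end MonoidalHochschild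

theorem mainTheorem2 {C : Type u} [Category.{v} C] [MonoidalCategory C]
    {D : Type u'} [Category.{v'} D] [Preadditive D] [MonoidalCategory D] [MonoidalPreadditive D]
    (F : C ⥤ D) [F.LaxMonoidal] :
    (∀ (k : ℕ) (c : MonoidalHochschild.Cochain F k),
      MonoidalHochschild.d F (k + 1) (MonoidalHochschild.d F k c) = 0) ∧
    ∃ G : GerstenhaberAlgebra (MonoidalHochschild.HH F),
      (∃ hη : MonoidalHochschild.unitCochain F ∈ MonoidalHochschild.cocycles F 0,
        G.one = MonoidalHochschild.cls F (MonoidalHochschild.unitCochain F) hη) ∧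
      (∀ (i j n : ℕ) (h : i + j = n)
        (x : MonoidalHochschild.Cochain F i) (hx : x ∈ MonoidalHochschild.cocycles F i)
        (y : MonoidalHochschild.Cochain F j) (hy : y ∈ MonoidalHochschild.cocycles F j),
        ∃ hxy : MonoidalHochschild.cup x y h ∈ MonoidalHochschild.cocycles F n,
          G.mul (i := i) (j := j) (n := n) (by exact_mod_cast h)
            (MonoidalHochschild.cls F x hx) (MonoidalHochschild.cls F y hy) =
              MonoidalHochschild.cls F (MonoidalHochschild.cup x y h) hxy) ∧
      (∀ (i j n : ℕ) (h : i + j = n + 1)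
        (x : MonoidalHochschild.Cochain F i) (hx : x ∈ MonoidalHochschild.cocycles F i)
        (y : MonoidalHochschild.Cochain F j) (hy : y ∈ MonoidalHochschild.cocycles F j),
        ∃ hxy : MonoidalHochschild.bracket x y h ∈ MonoidalHochschild.cocycles F n,
          G.bracket (i := i) (j := j) (n := n) (by exact_mod_cast h)
            (MonoidalHochschild.cls F x hx) (MonoidalHochschild.cls F y hy) =
              MonoidalHochschild.cls F (MonoidalHochschild.bracket x y h) hxy) := by
  open MonoidalHochschild in
  have mk_congr {n : ℤ} {x y : (operad F).Z n} (h : (x : TotalCochain F) = y) :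
      (QuotientAddGroup.mk x : (operad F).Coh n) = QuotientAddGroup.mk y :=
    congrArg _ (Subtype.ext h)
  open MonoidalHochschild in
  refine ⟨d_d, (operad F).gerstenhaber.transport (cohEquiv F),
    ⟨mem_cocycles_iff.2 SignedOperad.unit_mem_Z, ?_⟩,
    fun i j n h x hx y hy => ⟨cup_mem_cocycles hx hy h, ?_⟩,
    fun i j n h x hx y hy => ⟨bracket_mem_cocycles hx hy h, ?_⟩⟩
  · exact (AddEquiv.symm_apply_eq _).2 rfl
  · refine (AddEquiv.symm_apply_eq (cohEquiv F n)).2 ?_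
    exact mk_congr (total_cup x y h).symm
  · refine (AddEquiv.symm_apply_eq (cohEquiv F n)).2 ?_
    exact mk_congr (total_bracket x y h).symm
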